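/- Conventions. Let $F$ be a field of characteristic $\neq 2$ and let $A$ be an algebra over $F$ (not necessarily associative, commutative or unital). For $a\in A$ and $\mu,\eta\in F$ put $A_{\mu,\eta}(a)=\{x\in A: ax=\mu x,\ xa=\eta x\}$. For $\lambda,\delta\in F\setminus\{0,1\}$, a *primitive axis of type $(\lambda,\delta)$* in $A$ is a nonzero idempotent $a$ such that $a(ya)=(ay)a$ for all $y\in A$, $\{x: ax=x\}=Fa=\{x: xa=x\}$, $A=Fa\oplus A_{0,0}(a)\oplus A_{\lambda,\delta}(a)$, and this decomposition is a $\mathbb Z/2$-grading of $A$ with even part $Fa\oplus A_{0,0}(a)$ and odd part $A_{\lambda,\delta}(a)$. A *PAJ* (primitive axial algebra of Jordan type) is an algebra generated by a set of primitive axes, possibly of different types; a *CPAJ* is a commutative PAJ. A PAJ is *uniformly generated of type $\{\lambda,\delta\}$* if it is generated by primitive axes of types $(\lambda,\delta)$ and $(\delta,\lambda)$. For a nonempty set $E$, $U_E(\lambda)$ is the algebra with basis $E$ and multiplication $ef=(1-\lambda)e+\lambda f$ for $e,f\in E$. A direct product of a possibly infinite family of algebras means the restricted one (the direct sum, with componentwise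 multiplication). Theorem. Let $A$ be a PAJ over $F$. Then $A$ is the internal direct product of a family of subalgebras $(A_i)_{i\in I}$ and one further subalgebra $C$, where $C$ is a CPAJ (possibly zero) and, for each $i\in I$, there is $\lambda=\lambda_i\in F\setminus\{0,1\}$ such that, with $\delta=1-\lambda$, we have $\lambda\ne\delta$, and $A_i$ is a noncommutative PAJ that is uniformly generated of type $\{\lambda,\delta\}$ and has the following structure. 1. Let $a,a'\in A_i$ be primitive axes of $A_i$ of type $(\lambda,\delta)$ and $b\in A_i$ one of type $(\delta,\lambda)$. If $aa'\neq0$, then $ab,ba\in (A_i)_{\lambda,\delta}(a')$; if $aa'=0$, then $ab,ba\in (A_i)_{0,0}(a')$. The same holds with $\lambda$ and $\delta$ interchanged. 2. If $u\in A_i$ satisfies $A_iu=0$ or $uA_i=0$, then $u=0$. 3. Let $X'$ and $X''$ be any sets of primitive axes of $A_i$ of type $(\lambda,\delta)$ and $(\delta,\lambda)$ respectively such that $X'\cup X''$ generates $A_i$. Let $A'$ and $A''$ be the subalgebras generated by $X'$ and by $X''$, and let $Z$ be the span of the products $x'x''$ with $x'\in X'$, $x''\in X''$. Then: * $A'$ is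 a direct product of algebras of the form $U_E(\lambda)$, and $A''$ is a direct product of algebras of the form $U_E(\delta)$; * $Z$ is an ideal of $A_i$, $Z^2=0$, and $A_i=A'+A''+Z$; * $A_i/Z$ is the direct product of the images of $A'$ and $A''$, that is, $(A'+Z)\cap(A''+Z)=Z$, $A'A''\subseteq Z$ and $A''A'\subseteq Z$; * if $a,x\in A_i$ are primitive axes of type $(\lambda,\delta)$ with $ax\ne0$, then $(A_i)_{0,0}(a)\cap Z=(A_i)_{0,0}(x)\cap Z$ and $(A_i)_{\lambda,\delta}(a)\cap Z=(A_i)_{\lambda,\delta}(x)\cap Z$; * if $X'$ and $X''$ are finite, then $A_i$ is finite-dimensional. -/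

import Mathlib

universe u v

namespace PAJ

section Basic

variable (F : Type*) {A : Type*} [Field F] [NonUnitalNonAssocRing A] [Module F A]
  [IsScalarTower F A A] [SMulCommClass F A A]

/-- The `μ`-eigenspace of the left multiplication `L_a : x ↦ a * x`. -/
def leftEigenspace (a : A) (μ : F) : Submodule F A where
  carrier := {x | a * x = μ • x}
  zero_mem' := by simp
  add_mem' := by
    intro x y hx hy
    simp only [Set.mem_ofPred_eq] at hx hy ⊢
    rw [mul_add, hx, hy, smul_add]
  smul_mem' := by
    intro c x hx
    simp only [Set.mem_ofPred_eq] at hx ⊢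
    rw [mul_smul_comm, hx, smul_comm]

/-- The `η`-eigenspace of the right multiplication `R_a : x ↦ x * a`. -/
def rightEigenspace (a : A) (η : F) : Submodule F A where
  carrier := {x | x * a = η • x}
  zero_mem' := by simp
  add_mem' := by
    intro x y hx hy
    simp only [Set.mem_ofPred_eq] at hx hy ⊢
    rw [add_mul, hx, hy, smul_add]
  smul_mem' := by
    intro c x hx
    simp only [Set.mem_ofPred_eq] at hx ⊢
    rw [smul_mul_assoc, hx, smul_comm]

/-- The two-sided eigenspace `A_{μ,η}(a) = A_μ(L_a) ∩ A_η(R_a)`. -/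
def eigenspace (a : A) (μ η : F) : Submodule F A :=
  leftEigenspace F a μ ⊓ rightEigenspace F a η

/-- `a` is a primitive axis of type `(lam, del)`: a nonzero idempotent with `L_a R_a = R_a L_a`,
`A_1(L_a) = F a = A_1(R_a)`, and `A = F a ⊕ A_{0,0}(a) ⊕ A_{lam,del}(a)`, where the decomposition
into `F a ⊕ A_{0,0}(a)` (even part) and `A_{lam,del}(a)` (odd part) is a `ℤ/2`-grading of `A`.
(The sum is direct automatically, as the three spaces are eigenspaces of `L_a` for the distinct
eigenvalues `1`, `0`, `lam`. The odd part may be zero.) -/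
structure IsPrimitiveAxis (lam del : F) (a : A) : Prop where
  lam_ne_zero : lam ≠ 0
  lam_ne_one : lam ≠ 1
  del_ne_zero : del ≠ 0
  del_ne_one : del ≠ 1
  ne_zero : a ≠ 0
  idem : a * a = a
  comm : ∀ y : A, a * (y * a) = (a * y) * a
  left_primitive : leftEigenspace F a 1 = Submodule.span F {a}
  right_primitive : rightEigenspace F a 1 = Submodule.span F {a}
  decomposition : Submodule.span F {a} ⊔ eigenspace F a 0 0 ⊔ eigenspace F a lam del = ⊤
  even_mul_even : ∀ x ∈ Submodule.span F {a} ⊔ eigenspace F a 0 0,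
    ∀ y ∈ Submodule.span F {a} ⊔ eigenspace F a 0 0,
      x * y ∈ Submodule.span F {a} ⊔ eigenspace F a 0 0
  even_mul_odd : ∀ x ∈ Submodule.span F {a} ⊔ eigenspace F a 0 0,
    ∀ y ∈ eigenspace F a lam del, x * y ∈ eigenspace F a lam del
  odd_mul_even : ∀ x ∈ eigenspace F a lam del,
    ∀ y ∈ Submodule.span F {a} ⊔ eigenspace F a 0 0, x * y ∈ eigenspace F a lam del
  odd_mul_odd : ∀ x ∈ eigenspace F a lam del, ∀ y ∈ eigenspace F a lam del,
    x * y ∈ Submodule.span F {a} ⊔ eigenspace F a 0 0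

variable (A)

/-- `A` is a primitive axial algebra of Jordan type: it is generated by a set of primitive axes,
whose types may differ. -/
def IsPAJ : Prop :=
  ∃ X : Set A, (∀ x ∈ X, ∃ lam del : F, IsPrimitiveAxis F lam del x) ∧
    NonUnitalAlgebra.adjoin F X = ⊤

/-- A CPAJ: a commutative PAJ. -/
def IsCPAJ : Prop :=
  IsPAJ F A ∧ ∀ x y : A, x * y = y * x

/-- `A` is uniformly generated of type `{lam, del}`: it is generated by primitive axes of the
types `(lam, del)` and `(del, lam)`. -/
def IsUniformlyGenerated (lam del : F) : Prop :=
  ∃ X : Set A, (∀ x ∈ X, IsPrimitiveAxis F lam del x ∨ IsPrimitiveAxis F del lam x) ∧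
    NonUnitalAlgebra.adjoin F X = ⊤

/-- `A` is an algebra `U_E(lam)`: it has a (nonempty) basis `E` over `F` with multiplication
`e * f = (1 - lam) e + lam f` for all `e, f ∈ E`. -/
def IsU (lam : F) : Prop :=
  ∃ E : Set A, E.Nonempty ∧ LinearIndependent F ((↑) : E → A) ∧ Submodule.span F E = ⊤ ∧
    ∀ e ∈ E, ∀ f ∈ E, e * f = (1 - lam) • e + lam • f

variable {F A}

/-- `A` is the (internal, restricted) direct product of the subalgebras `B i`: it is the direct
sum of the subspaces `B i`, and distinct factors multiply to zero. In other words, every element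
of `A` is uniquely a finitely supported sum of elements of the `B i`, and addition and
multiplication are componentwise. For a finite family this is the direct product. -/
def IsDirectProduct {ι : Type*} (B : ι → NonUnitalSubalgebra F A) : Prop :=
  iSupIndep (fun i => (B i).toSubmodule) ∧ (⨆ i, (B i).toSubmodule) = ⊤ ∧
    ∀ i j, i ≠ j → ∀ x ∈ B i, ∀ y ∈ B j, x * y = 0

end Basic

section Description

variable (F : Type u) (A : Type v) [Field F] [NonUnitalNonAssocRing A] [Module F A]
  [IsScalarTower F A A] [SMulCommClass F A A]

/-- `A` is a direct product of algebras `U_E(lam)`, for various sets `E`. -/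
def IsProductOfU (lam : F) : Prop :=
  ∃ (κ : Type v) (D : κ → NonUnitalSubalgebra F A),
    IsDirectProduct D ∧ ∀ k, IsU F (D k) lam

variable {A}

/-- The subspace `Z` spanned by all products `x' * x''` with `x' ∈ X'` and `x'' ∈ X''`. -/
def crossSpan (X' X'' : Set A) : Submodule F A :=
  Submodule.span F {z | ∃ x' ∈ X', ∃ x'' ∈ X'', z = x' * x''}

variable (A)

/-- How an axis of one type acts on a product of axes of the types `(lam, del)` and `(del, lam)`:
for primitive axes `a, a'` of type `(lam, del)` and `b` of type `(del, lam)`, both `a * b` and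
`b * a` lie in `A_{lam,del}(a')` if `a * a' ≠ 0`, and in `A_{0,0}(a')` if `a * a' = 0`. -/
def CrossProductRule (lam del : F) : Prop :=
  ∀ a a' b : A, IsPrimitiveAxis F lam del a → IsPrimitiveAxis F lam del a' →
    IsPrimitiveAxis F del lam b →
      (a * a' ≠ 0 → a * b ∈ eigenspace F a' lam del ∧ b * a ∈ eigenspace F a' lam del) ∧
      (a * a' = 0 → a * b ∈ eigenspace F a' 0 0 ∧ b * a ∈ eigenspace F a' 0 0)

/-- The structure of a uniformly generated algebra `A` of type `{lam, del}`, `del = 1 - lam`,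
in terms of arbitrary generating sets `X'` and `X''` of axes of type `(lam, del)` and
`(del, lam)`, the subalgebras `A'` and `A''` that these generate, and the space `Z` spanned by
the products `x' * x''`. -/
structure HasNoncommutativeStructure (lam : F) : Prop where
  cross : CrossProductRule F A lam (1 - lam)
  cross_symm : CrossProductRule F A (1 - lam) lam
  /-- `A` has no nonzero annihilating element, on either side. -/
  no_annihilating : ∀ u : A, (∀ x : A, x * u = 0) ∨ (∀ x : A, u * x = 0) → u = 0
  structure_of_generators : ∀ X' X'' : Set A,
    (∀ x ∈ X', IsPrimitiveAxis F lam (1 - lam) x) →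
    (∀ x ∈ X'', IsPrimitiveAxis F (1 - lam) lam x) →
    NonUnitalAlgebra.adjoin F (X' ∪ X'') = ⊤ →
      -- `A'` is a product of algebras `U_E(lam)`, and `A''` of algebras `U_E(1 - lam)`
      IsProductOfU F (NonUnitalAlgebra.adjoin F X') lam ∧
      IsProductOfU F (NonUnitalAlgebra.adjoin F X'') (1 - lam) ∧
      -- `Z` is an ideal with `Z * Z = 0`
      (∀ z ∈ crossSpan F X' X'', ∀ x : A,
        x * z ∈ crossSpan F X' X'' ∧ z * x ∈ crossSpan F X' X'') ∧
      (∀ z ∈ crossSpan F X' X'', ∀ w ∈ crossSpan F X' X'', z * w = 0) ∧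
      -- `A = A' + A'' + Z`
      (NonUnitalAlgebra.adjoin F X').toSubmodule ⊔ (NonUnitalAlgebra.adjoin F X'').toSubmodule ⊔
        crossSpan F X' X'' = ⊤ ∧
      -- `A / Z` is the direct product of the images of `A'` and `A''`
      ((NonUnitalAlgebra.adjoin F X').toSubmodule ⊔ crossSpan F X' X'') ⊓
        ((NonUnitalAlgebra.adjoin F X'').toSubmodule ⊔ crossSpan F X' X'') =
          crossSpan F X' X'' ∧
      (∀ x ∈ NonUnitalAlgebra.adjoin F X', ∀ y ∈ NonUnitalAlgebra.adjoin F X'',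
        x * y ∈ crossSpan F X' X'' ∧ y * x ∈ crossSpan F X' X'') ∧
      -- axes `a, x` of type `(lam, 1 - lam)` with nonzero product have the same eigenvectors in `Z`
      (∀ a x : A, IsPrimitiveAxis F lam (1 - lam) a → IsPrimitiveAxis F lam (1 - lam) x →
        a * x ≠ 0 →
          eigenspace F a 0 0 ⊓ crossSpan F X' X'' = eigenspace F x 0 0 ⊓ crossSpan F X' X'' ∧
          eigenspace F a lam (1 - lam) ⊓ crossSpan F X' X'' =
            eigenspace F x lam (1 - lam) ⊓ crossSpan F X' X'') ∧
      -- finitely many generators give a finite-dimensional algebra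
      (X'.Finite → X''.Finite → FiniteDimensional F A)

end Description

end PAJ

/-! The Miyamoto involution of an axis `a`, which negates the odd part, is an automorphism, and `a *
x` is a combination of `a`, `x` and the image of `x`. Automorphisms carry axes to axes, so a PAJ is
spanned by its axes (`span_axes_eq_top`), and everything reduces to products of two axes.

If two axes do not commute, the first has a type with `lam + del = 1` and the second has the same
type or the swapped one (`noncommuting`). If they commute and one has `lam ≠ del`, they are equal or
orthogonal (`eq_or_mul_eq_zero`). A noncentral axis fails to commute with some axis, so the
noncentral axes fall into classes labelled by unordered pairs `{lam, 1 - lam}`. Distinct classes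
annihilate each other and the central axes. The classes span the factors `A_i`, the central axes
span `C`, and the sum is direct because no `A_i` contains a nonzero annihilating element.

Inside a factor, nonorthogonality is an equivalence relation on the axes of one type
(`mul_ne_zero_trans`), which yields the algebras `U_E`. For axes `a`, `b` of swapped types, `a * b`
is a multiple of `a - a'` with `a'` equivalent to `a` (`mul_swapped_type`). Hence `a * b` is an
eigenvector of every axis of the type of `a`, with eigenvalues depending only on the class of that
axis. So equivalent axes act alike on `Z`, which makes `Z` an ideal with `Z * Z = 0`. Finally, a
combination of axes of one type which those axes multiply into `Z` lies in `Z` (`mem_of_mul_mem`);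
this gives directness modulo `Z` and the absence of annihilating elements. -/

namespace PAJ

/-! ### A single axis: decomposition and Miyamoto involution -/

section Axis

variable {F : Type*} {A : Type*} [Field F] [NonUnitalNonAssocRing A] [Module F A]
  [IsScalarTower F A A] [SMulCommClass F A A]

theorem mem_eigenspace {a x : A} {μ η : F} :
    x ∈ eigenspace F a μ η ↔ a * x = μ • x ∧ x * a = η • x := Iff.rfl

variable (F) in
/-- The even part `F a ⊕ A_{0,0}(a)` of the grading defined by an axis `a`. -/
def evenPart (a : A) : Submodule F A := Submodule.span F {a} ⊔ eigenspace F a 0 0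

theorem mem_evenPart {a x : A} :
    x ∈ evenPart F a ↔ ∃ (c : F) (y : A), a * y = 0 ∧ y * a = 0 ∧ x = c • a + y := by
  simp only [evenPart, Submodule.mem_sup, Submodule.mem_span_singleton, mem_eigenspace, zero_smul]
  constructor
  · rintro ⟨_, ⟨c, rfl⟩, y, ⟨h1, h2⟩, rfl⟩
    exact ⟨c, y, h1, h2, rfl⟩
  · rintro ⟨c, y, h1, h2, rfl⟩
    exact ⟨_, ⟨c, rfl⟩, y, ⟨h1, h2⟩, rfl⟩

theorem mem_evenPart_of_mul_eq_zero {a x : A} (h : a * x = 0) (h' : x * a = 0) :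
    x ∈ evenPart F a := mem_evenPart.2 ⟨0, x, h, h', by simp⟩

theorem self_mem_evenPart (a : A) : a ∈ evenPart F a :=
  Submodule.mem_sup_left (Submodule.mem_span_singleton_self a)

/-- The projection onto the odd part of the grading defined by an axis `a`, given by the
polynomial `(t ^ 2 - t) / (lam ^ 2 - lam)` in the left multiplication by `a`. -/
def oddProj (lam : F) (a : A) : A →ₗ[F] A :=
  (lam ^ 2 - lam)⁻¹ • (LinearMap.mulLeft F a ∘ₗ LinearMap.mulLeft F a - LinearMap.mulLeft F a)

/-- The Miyamoto involution of an axis. -/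
def miyamoto (lam : F) (a : A) : A →ₗ[F] A := LinearMap.id - (2 : F) • oddProj lam a

omit [IsScalarTower F A A] in
theorem oddProj_apply (lam : F) (a x : A) :
    oddProj lam a x = (lam ^ 2 - lam)⁻¹ • (a * (a * x) - a * x) := rfl

omit [IsScalarTower F A A] in
theorem miyamoto_apply (lam : F) (a x : A) :
    miyamoto lam a x = x - (2 : F) • oddProj lam a x := rfl

namespace IsPrimitiveAxis

variable {lam del lam' del' : F} {a b : A}

theorem sq_sub_ne_zero (h : IsPrimitiveAxis F lam del a) : lam ^ 2 - lam ≠ 0 := by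
  have : lam ^ 2 - lam = lam * (lam - 1) := by ring
  rw [this]
  exact mul_ne_zero h.lam_ne_zero (sub_ne_zero.2 h.lam_ne_one)

theorem exists_even_odd (h : IsPrimitiveAxis F lam del a) (x : A) :
    ∃ e ∈ evenPart F a, ∃ o ∈ eigenspace F a lam del, x = e + o := by
  have := h.decomposition ▸ Submodule.mem_top (R := F) (x := x)
  obtain ⟨e, he, o, ho, rfl⟩ := Submodule.mem_sup.1 this
  exact ⟨e, he, o, ho, rfl⟩

theorem exists_decomp (h : IsPrimitiveAxis F lam del a) (x : A) :
    ∃ (c : F) (y z : A), a * y = 0 ∧ y * a = 0 ∧ a * z = lam • z ∧ z * a = del • z ∧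
      x = c • a + y + z := by
  obtain ⟨e, he, o, ho, rfl⟩ := h.exists_even_odd x
  obtain ⟨c, y, h1, h2, rfl⟩ := mem_evenPart.1 he
  exact ⟨c, y, o, h1, h2, ho.1, ho.2, rfl⟩

theorem oddProj_of_even (h : IsPrimitiveAxis F lam del a) {x : A} (hx : x ∈ evenPart F a) :
    oddProj lam a x = 0 := by
  obtain ⟨c, y, h1, h2, rfl⟩ := mem_evenPart.1 hx
  simp [oddProj_apply, mul_add, h1, h.idem, mul_smul_comm]

theorem oddProj_of_odd (h : IsPrimitiveAxis F lam del a) {x : A}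
    (hx : a * x = lam • x) : oddProj lam a x = x := by
  rw [oddProj_apply, hx, mul_smul_comm, hx, smul_smul, ← sub_smul, smul_smul, ← pow_two,
    inv_mul_cancel₀ h.sq_sub_ne_zero, one_smul]

theorem even_odd_unique (h : IsPrimitiveAxis F lam del a) {e o : A} (he : e ∈ evenPart F a)
    (ho : o ∈ eigenspace F a lam del) (heo : e + o = 0) : e = 0 ∧ o = 0 := by
  have : o = 0 := by
    have := congrArg (oddProj lam a) heo
    rwa [map_add, h.oddProj_of_even he, h.oddProj_of_odd ho.1, zero_add, map_zero] at this
  subst this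
  simpa using heo

theorem decomp_unique (h : IsPrimitiveAxis F lam del a) {c : F} {y z : A} (hy : a * y = 0)
    (hy' : y * a = 0) (hz : a * z = lam • z) (hz' : z * a = del • z)
    (H : c • a + y + z = 0) : c = 0 ∧ y = 0 ∧ z = 0 := by
  obtain ⟨h1, h2⟩ := h.even_odd_unique (mem_evenPart.2 ⟨c, y, hy, hy', rfl⟩) ⟨hz, hz'⟩ H
  have h3 := congrArg (a * ·) h1
  simp only [mul_add, mul_smul_comm, h.idem, hy, add_zero, mul_zero] at h3
  have h4 : c = 0 := (smul_eq_zero.1 h3).resolve_right h.ne_zero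
  subst h4
  exact ⟨rfl, by simpa using h1, h2⟩

/-- The eigenvalues `1`, `lam`, `del` are nonzero, so either product vanishes exactly when `x` lies
in `A_{0,0}(a)`. -/
theorem mul_eq_zero_comm (h : IsPrimitiveAxis F lam del a) {x : A} :
    a * x = 0 ↔ x * a = 0 := by
  obtain ⟨c, y, z, h1, h2, h3, h4, rfl⟩ := h.exists_decomp x
  simp only [mul_add, add_mul, mul_smul_comm, smul_mul_assoc, h.idem, h1, h2, h3, h4, add_zero]
  constructor <;> intro H
  · have := h.decomp_unique (y := 0) (by simp) (by simp) (z := lam • z)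
      (by rw [mul_smul_comm, h3]) (by rw [smul_mul_assoc, h4, smul_comm]) (by simpa using H)
    rw [this.1, (smul_eq_zero.1 this.2.2).resolve_left h.lam_ne_zero]
    simp
  · have := h.decomp_unique (y := 0) (by simp) (by simp) (z := del • z)
      (by rw [mul_smul_comm, h3, smul_comm]) (by rw [smul_mul_assoc, h4]) (by simpa using H)
    rw [this.1, (smul_eq_zero.1 this.2.2).resolve_left h.del_ne_zero]
    simp

theorem miyamoto_add (h : IsPrimitiveAxis F lam del a) {e o : A} (he : e ∈ evenPart F a)
    (ho : o ∈ eigenspace F a lam del) : miyamoto lam a (e + o) = e - o := by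
  rw [miyamoto_apply, map_add, h.oddProj_of_even he, h.oddProj_of_odd ho.1, zero_add, two_smul]
  abel

theorem miyamoto_miyamoto (h : IsPrimitiveAxis F lam del a) (x : A) :
    miyamoto lam a (miyamoto lam a x) = x := by
  obtain ⟨e, he, o, ho, rfl⟩ := h.exists_even_odd x
  rw [h.miyamoto_add he ho, sub_eq_add_neg, h.miyamoto_add he (neg_mem ho)]
  simp

theorem miyamoto_mul (h : IsPrimitiveAxis F lam del a) (x y : A) :
    miyamoto lam a (x * y) = miyamoto lam a x * miyamoto lam a y := by
  obtain ⟨e, he, o, ho, rfl⟩ := h.exists_even_odd x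
  obtain ⟨e', he', o', ho', rfl⟩ := h.exists_even_odd y
  have key : (e + o) * (e' + o') = (e * e' + o * o') + (e * o' + o * e') := by
    simp only [add_mul, mul_add]; abel
  rw [h.miyamoto_add he ho, h.miyamoto_add he' ho', key,
    h.miyamoto_add (add_mem (h.even_mul_even e he e' he') (h.odd_mul_odd o ho o' ho'))
      (add_mem (h.even_mul_odd e he o' ho') (h.odd_mul_even o ho e' he'))]
  simp only [sub_mul, mul_sub]; abel

/-- An involutive automorphism maps axes to axes of the same type. -/
theorem map_involution (h : IsPrimitiveAxis F lam del a) (t : A →ₗ[F] A)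
    (ht : ∀ x, t (t x) = x) (hmul : ∀ x y, t (x * y) = t x * t y) :
    IsPrimitiveAxis F lam del (t a) := by
  have hinj : Function.Injective t := fun x y hxy => by rw [← ht x, hxy, ht]
  have hl : ∀ μ, leftEigenspace F (t a) μ = (leftEigenspace F a μ).comap t := by
    intro μ
    ext x
    change t a * x = μ • x ↔ a * t x = μ • t x
    rw [← hinj.eq_iff, hmul, ht, map_smul]
  have hr : ∀ μ, rightEigenspace F (t a) μ = (rightEigenspace F a μ).comap t := by
    intro μ
    ext x
    change x * t a = μ • x ↔ t x * a = μ • t x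
    rw [← hinj.eq_iff, hmul, ht, map_smul]
  have he : ∀ μ η, eigenspace F (t a) μ η = (eigenspace F a μ η).comap t := by
    intro μ η
    rw [eigenspace, hl, hr, ← Submodule.comap_inf]; rfl
  have hs : Submodule.span F {t a} = (Submodule.span F {a}).comap t := by
    ext x
    rw [Submodule.mem_comap, Submodule.mem_span_singleton, Submodule.mem_span_singleton]
    refine exists_congr fun c => ?_
    rw [← hinj.eq_iff, map_smul, ht]
  have hev : Submodule.span F {t a} ⊔ eigenspace F (t a) 0 0
      = (Submodule.span F {a} ⊔ eigenspace F a 0 0).comap t := by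
    ext x
    rw [Submodule.mem_comap]
    change x ∈ evenPart F (t a) ↔ t x ∈ evenPart F a
    rw [mem_evenPart, mem_evenPart]
    constructor
    · rintro ⟨c, y, h1, h2, rfl⟩
      refine ⟨c, t y, ?_, ?_, by rw [map_add, map_smul, ht]⟩
      · rw [← hinj.eq_iff, hmul, ht, h1, map_zero]
      · rw [← hinj.eq_iff, hmul, ht, h2, map_zero]
    · rintro ⟨c, y, h1, h2, h3⟩
      refine ⟨c, t y, ?_, ?_, by rw [← ht x, h3, map_add, map_smul]⟩
      · rw [← hmul, h1, map_zero]
      · rw [← hmul, h2, map_zero]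
  refine ⟨h.lam_ne_zero, h.lam_ne_one, h.del_ne_zero, h.del_ne_one, ?_, ?_, ?_, ?_, ?_, ?_, ?_, ?_,
    ?_, ?_⟩
  · intro h0
    exact h.ne_zero (hinj (by rw [h0, map_zero]))
  · rw [← hmul, h.idem]
  · intro y
    rw [← hinj.eq_iff]
    simp only [hmul, ht]
    exact h.comm _
  · rw [hl, hs, h.left_primitive]
  · rw [hr, hs, h.right_primitive]
  · rw [eq_top_iff]
    intro x _
    obtain ⟨e, hee, o, ho, hx⟩ := h.exists_even_odd (t x)
    rw [hev, he, ← ht x, hx, map_add]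
    refine Submodule.add_mem_sup ?_ ?_
    · rw [Submodule.mem_comap, ht]; exact hee
    · rw [Submodule.mem_comap, ht]; exact ho
  · rw [hev]
    intro x hx y hy
    rw [Submodule.mem_comap, hmul]
    exact h.even_mul_even _ hx _ hy
  · rw [hev, he]
    intro x hx y hy
    rw [Submodule.mem_comap, hmul]
    exact h.even_mul_odd _ hx _ hy
  · rw [hev, he]
    intro x hx y hy
    rw [Submodule.mem_comap, hmul]
    exact h.odd_mul_even _ hx _ hy
  · rw [hev, he]
    intro x hx y hy
    rw [Submodule.mem_comap, hmul]
    exact h.odd_mul_odd _ hx _ hy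

theorem miyamoto_isPrimitiveAxis (h : IsPrimitiveAxis F lam del a)
    (hb : IsPrimitiveAxis F lam' del' b) : IsPrimitiveAxis F lam' del' (miyamoto lam a b) :=
  hb.map_involution _ h.miyamoto_miyamoto h.miyamoto_mul

/-- The product of an axis `a` and an element `x` is a combination of `a`, `x` and the image of `x`
under the Miyamoto involution of `a`. -/
theorem mul_mem_span (h : IsPrimitiveAxis F lam del a) (h2 : (2 : F) ≠ 0) (x : A) :
    a * x ∈ Submodule.span F {a, x, miyamoto lam a x} := by
  obtain ⟨c, y, z, h1, h2', h3, h4, hx⟩ := h.exists_decomp x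
  have hm : miyamoto lam a x = x - (2 : F) • z := by
    rw [hx, h.miyamoto_add (mem_evenPart.2 ⟨c, y, h1, h2', rfl⟩) ⟨h3, h4⟩, two_smul]
    abel
  -- The odd part of `x` is half of `x - miyamoto lam a x`; this uses `2 ≠ 0`.
  have : a * x = c • a + (lam / 2) • (x - miyamoto lam a x) := by
    rw [hm, sub_sub_cancel, smul_smul, div_mul_cancel₀ _ h2, hx, mul_add, mul_add, h1, h3,
      mul_smul_comm, h.idem, add_zero]
  rw [this]
  refine add_mem (Submodule.smul_mem _ _ (Submodule.subset_span (by simp)))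
    (Submodule.smul_mem _ _ (sub_mem (Submodule.subset_span (by simp))
      (Submodule.subset_span (by simp))))

end IsPrimitiveAxis

end Axis

/-! ### Classification of pairs of axes -/

section TwoAxes

variable {F : Type*} {A : Type*} [Field F] [NonUnitalNonAssocRing A] [Module F A]
  [IsScalarTower F A A] [SMulCommClass F A A]

namespace IsPrimitiveAxis

variable {lam del lam' del' : F} {a b : A}

theorem lam_ne_del_of_mul_ne (ha : IsPrimitiveAxis F lam del a) {x : A} (h : a * x ≠ x * a) :
    lam ≠ del := by
  rintro rfl
  obtain ⟨c, y, z, h1, h2, h3, h4, rfl⟩ := ha.exists_decomp x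
  apply h
  simp only [mul_add, add_mul, mul_smul_comm, smul_mul_assoc, ha.idem, h1, h2, h3, h4]

/-- The type of an axis which is not central is unique. -/
theorem type_unique (ha : IsPrimitiveAxis F lam del a) (ha' : IsPrimitiveAxis F lam' del' a)
    {x : A} (h : a * x ≠ x * a) : lam = lam' ∧ del = del' := by
  obtain ⟨c, y, z, h1, h2, h3, h4, rfl⟩ := ha.exists_decomp x
  have hz : z ≠ 0 := by
    rintro rfl
    apply h
    simp only [mul_add, add_mul, mul_smul_comm, smul_mul_assoc, ha.idem, h1, h2, mul_zero, zero_mul]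
  -- The odd part `z` for the first type is decomposed with respect to the second. Being an
  -- eigenvector for `lam ≠ 0, 1`, it has only an odd component there.
  obtain ⟨d, v, w, k1, k2, k3, k4, hzw⟩ := ha'.exists_decomp z
  have e1 : (d - lam * d) • a + (-lam) • v + (lam' - lam) • w = 0 := by
    have : a * z = d • a + lam' • w := by
      rw [hzw]; simp only [mul_add, mul_smul_comm, ha.idem, k1, k3, add_zero]
    rw [h3, hzw] at this
    linear_combination (norm := module) - this
  obtain ⟨f1, f2, f3⟩ := ha'.decomp_unique (by rw [mul_smul_comm, k1, smul_zero])
    (by rw [smul_mul_assoc, k2, smul_zero]) (by rw [mul_smul_comm, k3, smul_comm])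
    (by rw [smul_mul_assoc, k4, smul_comm]) e1
  have hd : d = 0 := by
    have : d * (1 - lam) = 0 := by linear_combination f1
    exact (mul_eq_zero.1 this).resolve_right (sub_ne_zero.2 ha.lam_ne_one.symm)
  have hv : v = 0 := (smul_eq_zero.1 f2).resolve_left (neg_ne_zero.2 ha.lam_ne_zero)
  have hzw' : z = w := by rw [hzw, hd, hv]; simp
  subst hzw'
  refine ⟨(sub_eq_zero.1 ((smul_eq_zero.1 f3).resolve_right hz)).symm, ?_⟩
  have : (del - del') • z = 0 := by rw [sub_smul, ← h4, ← k4, sub_self]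
  exact sub_eq_zero.1 ((smul_eq_zero.1 this).resolve_right hz)

/-- Commuting axes, one of which has a noncommutative type, are equal or orthogonal. -/
theorem eq_or_mul_eq_zero (ha : IsPrimitiveAxis F lam del a) (hne : lam ≠ del)
    (hb : IsPrimitiveAxis F lam' del' b) (h : a * b = b * a) :
    a = b ∨ (a * b = 0 ∧ b * a = 0) := by
  obtain ⟨c, y, z, h1, h2, h3, h4, hx⟩ := ha.exists_decomp b
  have e1 : a * b = c • a + lam • z := by
    rw [hx]; simp only [mul_add, mul_smul_comm, ha.idem, h1, h3, add_zero]
  have e2 : b * a = c • a + del • z := by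
    rw [hx]; simp only [add_mul, smul_mul_assoc, ha.idem, h2, h4, add_zero]
  have hz : z = 0 := by
    have : (lam - del) • z = 0 := by
      rw [e1, e2, add_right_inj] at h
      rw [sub_smul, h, sub_self]
    exact (smul_eq_zero.1 this).resolve_left (sub_ne_zero.2 hne)
  rw [hz, smul_zero, add_zero] at e1 e2
  -- Now `b * a = c • a`, so `a` is itself an eigenvector of left multiplication by `b`; its
  -- components with respect to `b` are compared.
  obtain ⟨d, v, w, k1, k2, k3, k4, ha'⟩ := hb.exists_decomp a
  have e3 : b * a = d • b + lam' • w := by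
    rw [ha']; simp only [mul_add, mul_smul_comm, hb.idem, k1, k3, add_zero]
  rw [e2, ha'] at e3
  have e4 : (c * d - d) • b + c • v + (c - lam') • w = 0 := by
    linear_combination (norm := module) e3
  obtain ⟨f1, f2, f3⟩ := hb.decomp_unique (by rw [mul_smul_comm, k1, smul_zero])
    (by rw [smul_mul_assoc, k2, smul_zero]) (by rw [mul_smul_comm, k3, smul_comm])
    (by rw [smul_mul_assoc, k4, smul_comm]) e4
  by_cases hc : c = 0
  · right
    rw [e1, e2, hc, zero_smul]
    exact ⟨rfl, rfl⟩
  have hv : v = 0 := (smul_eq_zero.1 f2).resolve_left hc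
  subst hv
  rw [add_zero] at ha'
  by_cases hd : d = 0
  -- Here `a` would be odd for `b`, whereas `a = a * a` is even.
  · rw [hd, zero_smul, zero_add] at ha'
    subst ha'
    exfalso
    have h5 : a ∈ evenPart F b := by
      have := hb.odd_mul_odd a ⟨k3, k4⟩ a ⟨k3, k4⟩
      rwa [ha.idem] at this
    have h6 := hb.oddProj_of_odd k3
    rw [hb.oddProj_of_even h5] at h6
    exact ha.ne_zero h6.symm
  have hc1 : c = 1 := by
    have : (c - 1) * d = 0 := by linear_combination f1
    exact sub_eq_zero.1 ((mul_eq_zero.1 this).resolve_right hd)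
  have hw : w = 0 := by
    rw [hc1] at f3
    exact (smul_eq_zero.1 f3).resolve_left (sub_ne_zero.2 hb.lam_ne_one.symm)
  rw [hw, add_zero] at ha'
  left
  have h7 := ha.idem
  rw [ha', smul_mul_smul_comm, hb.idem, ← sub_eq_zero, ← sub_smul] at h7
  have h8 : d * (d - 1) = 0 := by
    linear_combination (smul_eq_zero.1 h7).resolve_right hb.ne_zero
  rw [ha', sub_eq_zero.1 ((mul_eq_zero.1 h8).resolve_left hd), one_smul]

/-- If `b` has a component in the odd part of `a` which lies in the plane spanned by `a` and `b`,
then `b` has no component in `A_{0,0}(a)`. -/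
theorem mul_of_odd_mem_span (ha : IsPrimitiveAxis F lam del a)
    (hb : b * b = b) {c p q : F} {y z : A} (h1 : a * y = 0) (h2 : y * a = 0)
    (h3 : a * z = lam • z) (h4 : z * a = del • z) (hx : b = c • a + y + z) (hz : z ≠ 0)
    (hpq : z = p • a + q • b) :
    c * (lam + del) = 1 ∧ a * b = (c * (1 - lam)) • a + lam • b ∧
      b * a = (c * (1 - del)) • a + del • b := by
  have e : (p + q * c) • a + q • y + (q - 1) • z = 0 := by
    rw [hx] at hpq
    linear_combination (norm := module) - hpq
  obtain ⟨f1, f2, f3⟩ := ha.decomp_unique (by rw [mul_smul_comm, h1, smul_zero])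
    (by rw [smul_mul_assoc, h2, smul_zero]) (by rw [mul_smul_comm, h3, smul_comm])
    (by rw [smul_mul_assoc, h4, smul_comm]) e
  have hq : q = 1 := sub_eq_zero.1 ((smul_eq_zero.1 f3).resolve_right hz)
  rw [hq, one_smul] at f2
  subst f2
  rw [add_zero] at hx
  have hzz : z * z ∈ evenPart F a := ha.odd_mul_odd z ⟨h3, h4⟩ z ⟨h3, h4⟩
  -- Since `z * z` is even, the odd part of `b * b = b` reads `c * (lam + del) = 1`.
  have e2 : b * b = c ^ 2 • a + (c * (lam + del)) • z + z * z := by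
    rw [hx]
    simp only [mul_add, add_mul, mul_smul_comm, smul_mul_assoc, ha.idem, h3, h4]
    module
  rw [hb, hx] at e2
  obtain ⟨-, g⟩ := ha.even_odd_unique (e := (c ^ 2 - c) • a + z * z)
    (o := (c * (lam + del) - 1) • z)
    (add_mem (Submodule.smul_mem _ _ (self_mem_evenPart a)) hzz)
    (Submodule.smul_mem _ _ ⟨h3, h4⟩) (by linear_combination (norm := module) - e2)
  refine ⟨sub_eq_zero.1 ((smul_eq_zero.1 g).resolve_right hz), ?_, ?_⟩
  · rw [hx]
    simp only [mul_add, mul_smul_comm, ha.idem, h3]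
    module
  · rw [hx]
    simp only [add_mul, smul_mul_assoc, ha.idem, h4]
    module

/-- If `b` has component `0` in `F a` and its odd component `z` for `a` is odd also for `b`, then
the type of `b` is of the form `(t, 1 - t)`. -/
theorem type_add_eq_one_of_odd (ha : IsPrimitiveAxis F lam del a) (hb : b * b = b)
    {y z : A} (h1 : a * y = 0) (h2 : y * a = 0)
    (h3 : a * z = lam • z) (h4 : z * a = del • z) (hx : b = y + z) (hz : z ≠ 0)
    (k1 : b * z = lam' • z) (k2 : z * b = del' • z) : lam' + del' = 1 := by
  have hyE := mem_evenPart_of_mul_eq_zero (F := F) h1 h2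
  have hzz : z * z ∈ evenPart F a := ha.odd_mul_odd z ⟨h3, h4⟩ z ⟨h3, h4⟩
  have hyy : y * y ∈ evenPart F a := ha.even_mul_even y hyE y hyE
  have hyz := ha.even_mul_odd y hyE z ⟨h3, h4⟩
  have hzy := ha.odd_mul_even z ⟨h3, h4⟩ y hyE
  have hzO : z ∈ eigenspace F a lam del := ⟨h3, h4⟩
  -- In `b * z = y * z + z * z` the first term is odd and the second even, so the eigenvalue
  -- equation already holds for `y`. Then the odd part of `b * b = b` gives the claim.
  have g1 : y * z = lam' • z := by
    have : z * z + (y * z - lam' • z) = 0 := by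
      rw [← k1, hx, add_mul]; abel
    exact sub_eq_zero.1
      (ha.even_odd_unique hzz (sub_mem hyz (Submodule.smul_mem _ _ hzO)) this).2
  have g2 : z * y = del' • z := by
    have : z * z + (z * y - del' • z) = 0 := by
      rw [← k2, hx, mul_add]; abel
    exact sub_eq_zero.1
      (ha.even_odd_unique hzz (sub_mem hzy (Submodule.smul_mem _ _ hzO)) this).2
  have g3 : (y * y + z * z - y) + (lam' + del' - 1) • z = 0 := by
    have : b * b = y * y + z * z + (lam' + del') • z := by
      rw [hx, add_smul, ← g1, ← g2]; simp only [add_mul, mul_add]; abel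
    rw [hb, hx] at this
    linear_combination (norm := module) - this
  have := (ha.even_odd_unique (sub_mem (add_mem hyy hzz) hyE) (Submodule.smul_mem _ _ hzO) g3).2
  exact sub_eq_zero.1 ((smul_eq_zero.1 this).resolve_right hz)

/-- Two axes that do not commute have types `(lam, 1 - lam)` and `(lam, 1 - lam)`, or
`(lam, 1 - lam)` and `(1 - lam, lam)`. In the first case they span an algebra `U(lam)`, in the
second they span together with their product an algebra of dimension three. -/
theorem noncommuting (ha : IsPrimitiveAxis F lam del a) (hb : IsPrimitiveAxis F lam' del' b)
    (h : a * b ≠ b * a) :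
    lam + del = 1 ∧ ((lam' = lam ∧ del' = del ∧ a * b = del • a + lam • b ∧
      b * a = del • b + lam • a) ∨
      (lam' = del ∧ del' = lam ∧ del • (a * b) = lam • (b * a) ∧ a * (a * b) = lam • (a * b) ∧
        b * (a * b) = lam' • (a * b) ∧ (a * b) * b = del' • (a * b) ∧
        ∃ y, b * y = 0 ∧ y * b = 0 ∧ lam • a = y + a * b)) := by
  have hld := ha.lam_ne_del_of_mul_ne h
  have hld' := hb.lam_ne_del_of_mul_ne h.symm
  obtain ⟨c, y, z, h1, h2, h3, h4, hx⟩ := ha.exists_decomp b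
  obtain ⟨d, v, w, k1, k2, k3, k4, hx'⟩ := hb.exists_decomp a
  have e1 : a * b = c • a + lam • z := by
    rw [hx]; simp only [mul_add, mul_smul_comm, ha.idem, h1, h3, add_zero]
  have e2 : b * a = c • a + del • z := by
    rw [hx]; simp only [add_mul, smul_mul_assoc, ha.idem, h2, h4, add_zero]
  have e3 : b * a = d • b + lam' • w := by
    conv_lhs => rw [hx']
    simp only [mul_add, mul_smul_comm, hb.idem, k1, k3, add_zero]
  have e4 : a * b = d • b + del' • w := by
    conv_lhs => rw [hx']
    simp only [add_mul, smul_mul_assoc, hb.idem, k2, k4, add_zero]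
  have hz : z ≠ 0 := by
    rintro rfl
    exact h (by rw [e1, e2]; simp)
  have hw : w ≠ 0 := by
    rintro rfl
    exact h (by rw [e3, e4]; simp)
  have indep : ∀ s t : F, s • a + t • b = 0 → s = 0 ∧ t = 0 := by
    intro s t hst
    rw [hx] at hst
    obtain ⟨f1, -, f3⟩ := ha.decomp_unique (c := s + t * c) (y := t • y) (z := t • z)
      (by rw [mul_smul_comm, h1, smul_zero])
      (by rw [smul_mul_assoc, h2, smul_zero]) (by rw [mul_smul_comm, h3, smul_comm])
      (by rw [smul_mul_assoc, h4, smul_comm]) (by linear_combination (norm := module) hst)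
    have ht := (smul_eq_zero.1 f3).resolve_right hz
    rw [ht] at f1
    exact ⟨by simpa using f1, ht⟩
  have s1 : c • a + lam • z = d • b + del' • w := by rw [← e1, e4]
  have s2 : c • a + del • z = d • b + lam' • w := by rw [← e2, e3]
  -- `s1` and `s2` form a linear system for `z` and `w` over the span of `a` and `b`, with this
  -- determinant up to sign. The singular case is that of swapped types, the regular case that of
  -- equal types.
  by_cases hdet : del * del' - lam * lam' = 0
  · have hcd : (del' * (del - lam) * c) • a + (del' * (lam - del) * d) • b = 0 := by
      have hdet' : (lam * lam') • w = (del * del') • w := by rw [sub_eq_zero.1 hdet]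
      linear_combination (norm := module) (del' * del) • s1 - (del' * lam) • s2 - del' • hdet'
    obtain ⟨f1, f2⟩ := indep _ _ hcd
    have hc : c = 0 := (mul_eq_zero.1 f1).resolve_left
      (mul_ne_zero hb.del_ne_zero (sub_ne_zero.2 hld.symm))
    have hd : d = 0 := (mul_eq_zero.1 f2).resolve_left
      (mul_ne_zero hb.del_ne_zero (sub_ne_zero.2 hld))
    subst hc hd
    rw [zero_smul, zero_add] at hx hx' e1 e2 e3 e4
    -- With `c = d = 0`, the vectors `z` and `w` are proportional to `a * b`, so each is odd for
    -- both axes.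
    have hzw : lam • z = del' • w := by rw [← e1, e4]
    have hz' : z = (lam⁻¹ * del') • w := by
      rw [mul_smul, ← hzw, smul_smul, inv_mul_cancel₀ ha.lam_ne_zero, one_smul]
    have hw' : w = (del'⁻¹ * lam) • z := by
      rw [mul_smul, hzw, smul_smul, inv_mul_cancel₀ hb.del_ne_zero, one_smul]
    have t' : lam' + del' = 1 := ha.type_add_eq_one_of_odd hb.idem h1 h2 h3 h4 hx hz
      (by rw [hz', mul_smul_comm, k3, smul_comm]) (by rw [hz', smul_mul_assoc, k4, smul_comm])
    have t : lam + del = 1 := hb.type_add_eq_one_of_odd ha.idem k1 k2 k3 k4 hx' hw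
      (by rw [hw', mul_smul_comm, h3, smul_comm]) (by rw [hw', smul_mul_assoc, h4, smul_comm])
    have hdel : del' = lam := by linear_combination hdet - del' * t + lam * t'
    refine ⟨t, Or.inr ⟨by linear_combination t' - t - hdel, hdel, ?_, ?_, ?_, ?_, lam • v,
      by rw [mul_smul_comm, k1, smul_zero], by rw [smul_mul_assoc, k2, smul_zero], ?_⟩⟩
    · rw [e1, e2, smul_comm]
    · rw [e1, mul_smul_comm, h3]
    · rw [e4, mul_smul_comm, k3, smul_comm]
    · rw [e4, smul_mul_assoc, k4]
    · conv_lhs => rw [hx']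
      rw [e4, hdel, ← smul_add]
  · obtain ⟨p, q, hpq⟩ : ∃ p q : F, z = p • a + q • b := by
      refine ⟨(del * del' - lam * lam')⁻¹ * ((lam' - del') * c),
        (del * del' - lam * lam')⁻¹ * ((del' - lam') * d), ?_⟩
      rw [mul_smul _ _ a, mul_smul _ _ b, ← smul_add, eq_inv_smul_iff₀ hdet]
      linear_combination (norm := module) del' • s2 - lam' • s1
    obtain ⟨p', q', hpq'⟩ : ∃ p q : F, w = p • b + q • a := by
      refine ⟨(del * del' - lam * lam')⁻¹ * ((lam - del) * d),
        (del * del' - lam * lam')⁻¹ * ((del - lam) * c), ?_⟩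
      rw [mul_smul _ _ a, mul_smul _ _ b, ← smul_add, eq_inv_smul_iff₀ hdet]
      linear_combination (norm := module) lam • s2 - del • s1
    obtain ⟨g1, g2, g3⟩ := ha.mul_of_odd_mem_span hb.idem h1 h2 h3 h4 hx hz hpq
    obtain ⟨g1', g2', g3'⟩ := hb.mul_of_odd_mem_span ha.idem k1 k2 k3 k4 hx' hw hpq'
    -- Both axes express `a * b` and `b * a` in terms of `a` and `b`. Comparing coefficients forces
    -- `c = d`, then `c ^ 2 = 1`, then `c = 1`.
    obtain ⟨r1, r2⟩ := indep (c * (1 - lam) - del') (lam - d * (1 - del')) (by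
      linear_combination (norm := module) g3' - g2)
    obtain ⟨r3, r4⟩ := indep (c * (1 - del) - lam') (del - d * (1 - lam')) (by
      linear_combination (norm := module) g2' - g3)
    have hcd : c = d := by
      have i1 : d * (2 * c - 1) = 1 := by linear_combination g1' + d * g1 + d * (r1 + r3)
      have i2 : c * (2 * d - 1) = 1 := by linear_combination g1 + c * g1' - c * (r2 + r4)
      linear_combination i1 - i2
    subst hcd
    have j1 : (c ^ 2 - 1) * (lam - del) = 0 := by
      linear_combination c * (r3 - r1) + (r4 - r2)
    have j2 : c ^ 2 - 1 = 0 := (mul_eq_zero.1 j1).resolve_right (sub_ne_zero.2 hld)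
    have hc : c = 1 := by
      linear_combination 2 * j2 - (g1' + c * g1 + c * (r1 + r3))
    subst hc
    have t : lam + del = 1 := by linear_combination g1
    refine ⟨t, Or.inl ⟨by linear_combination - r3 - t, by linear_combination - r1 - t, ?_, ?_⟩⟩
    · rw [g2]
      congr 2
      linear_combination - t
    · rw [g3, add_comm]
      congr 2
      linear_combination - t

end IsPrimitiveAxis

end TwoAxes

/-! ### Spans closed under multiplication -/

section Span

variable {F : Type*} {A : Type*} [Field F] [NonUnitalNonAssocRing A] [Module F A]
  [IsScalarTower F A A] [SMulCommClass F A A]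

theorem mul_mem_of_mem_span {X Y : Set A} {S : Submodule F A}
    (h : ∀ x ∈ X, ∀ y ∈ Y, x * y ∈ S) {x y : A} (hx : x ∈ Submodule.span F X)
    (hy : y ∈ Submodule.span F Y) : x * y ∈ S := by
  have h1 : ∀ x ∈ X, Submodule.span F Y ≤ S.comap (LinearMap.mulLeft F x) :=
    fun x hx => Submodule.span_le.2 fun y hy => h x hx y hy
  have h2 : Submodule.span F X ≤ S.comap (LinearMap.mulRight F y) :=
    Submodule.span_le.2 fun x hx => h1 x hx hy
  exact h2 hx

theorem mul_eq_zero_of_mem_span {X Y : Set A}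
    (h : ∀ x ∈ X, ∀ y ∈ Y, x * y = 0) {x y : A} (hx : x ∈ Submodule.span F X)
    (hy : y ∈ Submodule.span F Y) : x * y = 0 :=
  (Submodule.mem_bot F).1 (mul_mem_of_mem_span (S := ⊥)
    (fun x hx y hy => (Submodule.mem_bot F).2 (h x hx y hy)) hx hy)

theorem adjoin_toSubmodule_eq_span {X : Set A}
    (h : ∀ x ∈ X, ∀ y ∈ X, x * y ∈ Submodule.span F X) :
    (NonUnitalAlgebra.adjoin F X).toSubmodule = Submodule.span F X := by
  apply le_antisymm
  · let B : NonUnitalSubalgebra F A :=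
      { Submodule.span F X with
        mul_mem' := fun hx hy => mul_mem_of_mem_span h hx hy }
    exact (NonUnitalAlgebra.adjoin_le (S := B) Submodule.subset_span : _ ≤ B)
  · exact Submodule.span_le.2 (NonUnitalAlgebra.subset_adjoin F)

omit [IsScalarTower F A A] [SMulCommClass F A A] in
theorem span_preimage_eq_top {B : NonUnitalSubalgebra F A} {S : Set A}
    (h : B.toSubmodule = Submodule.span F S) :
    Submodule.span F {x : B | (x : A) ∈ S} = ⊤ := by
  rw [eq_top_iff]
  rintro ⟨x, hx⟩ -
  have hS : ∀ y ∈ Submodule.span F S, y ∈ B := fun y hy => by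
    rw [← h] at hy; exact hy
  have hx' : x ∈ Submodule.span F S := h ▸ hx
  have key : ∃ hx : x ∈ B, (⟨x, hx⟩ : B) ∈ Submodule.span F {x : B | (x : A) ∈ S} := by
    induction hx' using Submodule.span_induction with
    | mem y hy => exact ⟨hS y (Submodule.subset_span hy), Submodule.subset_span hy⟩
    | zero => exact ⟨zero_mem B, zero_mem _⟩
    | add y z hy hz h1 h2 =>
      obtain ⟨h1, h1'⟩ := h1 (hS _ hy)
      obtain ⟨h2, h2'⟩ := h2 (hS _ hz)
      exact ⟨add_mem h1 h2, add_mem h1' h2'⟩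
    | smul c y hy h1 =>
      obtain ⟨h1, h1'⟩ := h1 (hS _ hy)
      exact ⟨B.toSubmodule.smul_mem c h1, Submodule.smul_mem _ c h1'⟩
  exact key.2

theorem adjoin_eq_top_of_span_eq_top {X : Set A} (h : Submodule.span F X = ⊤) :
    NonUnitalAlgebra.adjoin F X = ⊤ := by
  rw [eq_top_iff]
  intro x _
  have : Submodule.span F X ≤ (NonUnitalAlgebra.adjoin F X).toSubmodule :=
    Submodule.span_le.2 (NonUnitalAlgebra.subset_adjoin F)
  exact this (h ▸ Submodule.mem_top)

theorem span_eq_top_of_adjoin_eq_top {X : Set A} (h : NonUnitalAlgebra.adjoin F X = ⊤)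
    {Y : Set A} (hXY : X ⊆ Y) (hY : ∀ x ∈ Y, ∀ y ∈ Y, x * y ∈ Submodule.span F Y) :
    Submodule.span F Y = ⊤ := by
  rw [← adjoin_toSubmodule_eq_span hY, eq_top_iff]
  intro x _
  have hx : x ∈ NonUnitalAlgebra.adjoin F X := h ▸ NonUnitalAlgebra.mem_top
  exact NonUnitalAlgebra.adjoin_mono hXY hx

end Span

/-! ### Families of idempotents with the multiplication of `U(lam)` -/

section Family

variable (F : Type*) {A : Type*} [Field F] [NonUnitalNonAssocRing A] [Module F A]
  [IsScalarTower F A A] [SMulCommClass F A A]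

/-- A set of nonzero idempotents on which having a nonzero product is an equivalence relation,
such that the elements of each class multiply as in an algebra `U(lam)`. -/
structure IsUFamily (lam : F) (X : Set A) : Prop where
  ne_zero : ∀ e ∈ X, e ≠ 0
  idem : ∀ e ∈ X, e * e = e
  mul : ∀ e ∈ X, ∀ f ∈ X, e * f ≠ 0 → e * f = (1 - lam) • e + lam • f
  symm : ∀ e ∈ X, ∀ f ∈ X, e * f ≠ 0 → f * e ≠ 0
  trans : ∀ e ∈ X, ∀ f ∈ X, ∀ g ∈ X, e * f ≠ 0 → f * g ≠ 0 → e * g ≠ 0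

variable {F} {lam : F} {X : Set A}

namespace IsUFamily

omit [IsScalarTower F A A] [SMulCommClass F A A] in
theorem mono (h : IsUFamily F lam X) {Y : Set A} (hY : Y ⊆ X) : IsUFamily F lam Y :=
  ⟨fun e he => h.ne_zero e (hY he), fun e he => h.idem e (hY he),
    fun e he f hf => h.mul e (hY he) f (hY hf), fun e he f hf => h.symm e (hY he) f (hY hf),
    fun e he f hf g hg => h.trans e (hY he) f (hY hf) g (hY hg)⟩

omit [IsScalarTower F A A] [SMulCommClass F A A] in
theorem mul_mem_span (h : IsUFamily F lam X) : ∀ x ∈ X, ∀ y ∈ X, x * y ∈ Submodule.span F X := by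
  intro x hx y hy
  by_cases hxy : x * y = 0
  · rw [hxy]; exact zero_mem _
  · rw [h.mul x hx y hy hxy]
    exact add_mem (Submodule.smul_mem _ _ (Submodule.subset_span hx))
      (Submodule.smul_mem _ _ (Submodule.subset_span hy))

theorem adjoin_toSubmodule (h : IsUFamily F lam X) :
    (NonUnitalAlgebra.adjoin F X).toSubmodule = Submodule.span F X :=
  adjoin_toSubmodule_eq_span h.mul_mem_span

/-- Elements of the span of a family are detected modulo an ideal `Z` by the left
multiplications with the elements of the family. -/
theorem mem_of_mul_mem (h : IsUFamily F lam X) (h0 : lam ≠ 0) {Z : Submodule F A}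
    (hZ : ∀ e ∈ X, ∀ z ∈ Z, e * z ∈ Z) {u : A} (hu : u ∈ Submodule.span F X)
    (hmul : ∀ e ∈ X, e * u ∈ Z) : u ∈ Z := by
  classical
  obtain ⟨t, htX, hut⟩ := Submodule.mem_span_finite_of_mem_span hu
  clear hu
  induction t using Finset.strongInduction generalizing u with
  | H t ih =>
    rcases t.eq_empty_or_nonempty with rfl | ⟨e, he⟩
    · simp only [Finset.coe_empty, Submodule.span_empty, Submodule.mem_bot] at hut
      rw [hut]; exact zero_mem _
    have heX := htX he
    have hee : e * e ≠ 0 := by rw [h.idem e heX]; exact h.ne_zero e heX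
    -- The class of `e` is split off from the finite support. The two parts are annihilated from the
    -- left by elements outside and inside this class respectively, so each part satisfies the
    -- hypothesis separately.
    have hsplit : (t : Set A) =
        ((t.filter fun f => e * f ≠ 0 : Finset A) : Set A) ∪ (t.filter fun f => e * f = 0 :
          Finset A) := by
      ext f
      simp only [Set.mem_union, Finset.mem_coe, Finset.mem_filter]
      tauto
    rw [hsplit, Submodule.span_union] at hut
    obtain ⟨u₁, hu₁, u₂, hu₂, rfl⟩ := Submodule.mem_sup.1 hut
    have z₁ : ∀ f ∈ X, e * f = 0 → f * u₁ = 0 := by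
      intro f hf hef
      refine mul_eq_zero_of_mem_span (F := F) (X := {f}) ?_
        (Submodule.mem_span_singleton_self f) hu₁
      rintro x rfl g hg
      obtain ⟨hg, hg'⟩ := Finset.mem_filter.1 (Finset.mem_coe.1 hg)
      by_contra hfg
      exact h.trans e heX g (htX hg) x hf hg' (h.symm x hf g (htX hg) hfg) hef
    have z₂ : ∀ f ∈ X, e * f ≠ 0 → f * u₂ = 0 := by
      intro f hf hef
      refine mul_eq_zero_of_mem_span (F := F) (X := {f}) ?_
        (Submodule.mem_span_singleton_self f) hu₂
      rintro x rfl g hg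
      obtain ⟨hg, hg'⟩ := Finset.mem_filter.1 (Finset.mem_coe.1 hg)
      by_contra hfg
      exact h.trans e heX x hf g (htX hg) hef hfg hg'
    have m₁ : ∀ f ∈ X, f * u₁ ∈ Z := by
      intro f hf
      by_cases hef : e * f = 0
      · rw [z₁ f hf hef]; exact zero_mem _
      · have := hmul f hf
        rwa [mul_add, z₂ f hf hef, add_zero] at this
    have m₂ : ∀ f ∈ X, f * u₂ ∈ Z := by
      intro f hf
      by_cases hef : e * f = 0
      · have := hmul f hf
        rwa [mul_add, z₁ f hf hef, zero_add] at this
      · rw [z₂ f hf hef]; exact zero_mem _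
    refine add_mem ?_ (ih _ ?_ m₂ ?_ hu₂)
    · obtain ⟨s, hs⟩ : ∃ s : F, e * u₁ = s • e + lam • u₁ := by
        clear z₁ m₁ hmul hut
        induction hu₁ using Submodule.span_induction with
        | mem f hf =>
          obtain ⟨hf, hf'⟩ := Finset.mem_filter.1 (Finset.mem_coe.1 hf)
          exact ⟨1 - lam, h.mul e heX f (htX hf) hf'⟩
        | zero => exact ⟨0, by simp⟩
        | add x y _ _ hx hy =>
          obtain ⟨s, hs⟩ := hx
          obtain ⟨s', hs'⟩ := hy
          exact ⟨s + s', by rw [mul_add, hs, hs']; module⟩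
        | smul c x _ hx =>
          obtain ⟨s, hs⟩ := hx
          exact ⟨c * s, by rw [mul_smul_comm, hs]; module⟩
      have hm := m₁ e heX
      -- With `e * u₁ = s • e + lam • u₁`, applying left multiplication by `e` minus `lam` to `e *
      -- u₁` leaves `s • e`.
      have hse : s • e ∈ Z := by
        have h2 := sub_mem (hZ e heX _ hm) (Submodule.smul_mem _ lam hm)
        rwa [hs, mul_add, mul_smul_comm, mul_smul_comm, h.idem e heX, hs, add_sub_cancel_right]
          at h2
      have : lam • u₁ ∈ Z := by
        have h3 := sub_mem hm hse
        rwa [hs, add_sub_cancel_left] at h3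
      exact (Submodule.smul_mem_iff _ h0).1 this
    · refine Finset.filter_ssubset.2 ⟨e, he, hee⟩
    · exact fun x hx => htX (Finset.mem_filter.1 (Finset.mem_coe.1 hx)).1

theorem eq_zero_of_mul_eq_zero (h : IsUFamily F lam X) (h0 : lam ≠ 0) {u : A}
    (hu : u ∈ Submodule.span F X) (hmul : ∀ e ∈ X, e * u = 0) : u = 0 :=
  (Submodule.mem_bot F).1 (h.mem_of_mul_mem h0 (Z := ⊥)
    (fun e _ z hz => by rw [(Submodule.mem_bot F).1 hz, mul_zero]; exact zero_mem _) hu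
    (fun e he => by rw [hmul e he]; exact zero_mem _))

end IsUFamily

end Family

/-! ### Decomposition into algebras `U_E` -/

section Product

variable {F : Type u} {A : Type v} [Field F] [NonUnitalNonAssocRing A] [Module F A]
  [IsScalarTower F A A] [SMulCommClass F A A] {lam : F} {X : Set A}

namespace IsUFamily

/-- The family may be linearly dependent, but any basis chosen from it inherits the multiplication
rule. -/
theorem isU (h : IsUFamily F lam X) (hX : X.Nonempty) (hmul : ∀ e ∈ X, ∀ f ∈ X, e * f ≠ 0) :
    IsU F (NonUnitalAlgebra.adjoin F X) lam := by
  have hT := span_preimage_eq_top h.adjoin_toSubmodule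
  obtain ⟨E, hE, hspan, hli⟩ :=
    exists_linearIndependent F {x : NonUnitalAlgebra.adjoin F X | (x : A) ∈ X}
  rw [hT] at hspan
  refine ⟨E, ?_, hli, hspan, ?_⟩
  · obtain ⟨x, hx⟩ := hX
    by_contra hE0
    rw [Set.not_nonempty_iff_eq_empty.1 hE0, Submodule.span_empty] at hspan
    have : (⟨x, NonUnitalAlgebra.subset_adjoin F hx⟩ : NonUnitalAlgebra.adjoin F X) = 0 := by
      rw [← Submodule.mem_bot F, hspan]; exact Submodule.mem_top
    exact h.ne_zero x hx (congrArg Subtype.val this)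
  · intro e he f hf
    exact Subtype.ext (h.mul e (hE he) f (hE hf) (hmul e (hE he) f (hE hf)))

/-- The factors belong to the classes of nonorthogonal elements. An element of one factor lying in
the sum of the others is annihilated by its own class, hence is zero by `eq_zero_of_mul_eq_zero`. -/
theorem isProductOfU (h : IsUFamily F lam X) (h0 : lam ≠ 0) (hX : Submodule.span F X = ⊤) :
    IsProductOfU F A lam := by
  have hself : ∀ e ∈ X, e * e ≠ 0 := fun e he => by rw [h.idem e he]; exact h.ne_zero e he
  have hclass : ∀ e ∈ X, ∀ f ∈ X, e * f ≠ 0 →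
      {g | g ∈ X ∧ e * g ≠ 0} = {g | g ∈ X ∧ f * g ≠ 0} := by
    intro e he f hf hef
    ext g
    exact ⟨fun hg => ⟨hg.1, h.trans f hf e he g hg.1 (h.symm e he f hf hef) hg.2⟩,
      fun hg => ⟨hg.1, h.trans e he f hf g hg.1 hef hg.2⟩⟩
  refine ⟨{S : Set A // ∃ e ∈ X, S = {g | g ∈ X ∧ e * g ≠ 0}},
    fun S => NonUnitalAlgebra.adjoin F S.1, ⟨?_, ?_, ?_⟩, ?_⟩
  · rintro ⟨_, e, he, rfl⟩
    rw [Submodule.disjoint_def]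
    intro u hu hu'
    have hfam : IsUFamily F lam {g | g ∈ X ∧ e * g ≠ 0} := h.mono fun g hg => hg.1
    simp only [hfam.adjoin_toSubmodule] at hu
    refine hfam.eq_zero_of_mul_eq_zero h0 hu ?_
    intro f hf
    have hle : (⨆ j : {S : Set A // ∃ e ∈ X, S = {g | g ∈ X ∧ e * g ≠ 0}},
        ⨆ (_ : j ≠ ⟨{g | g ∈ X ∧ e * g ≠ 0}, e, he, rfl⟩),
        (NonUnitalAlgebra.adjoin F j.1).toSubmodule) ≤ LinearMap.ker (LinearMap.mulLeft F f) := by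
      refine iSup₂_le ?_
      rintro ⟨_, e', he', rfl⟩ hj
      rw [(h.mono fun g hg => hg.1 : IsUFamily F lam {g | g ∈ X ∧ e' * g ≠ 0}).adjoin_toSubmodule]
      refine Submodule.span_le.2 fun g hg => ?_
      change f * g = 0
      by_contra hfg
      apply hj
      apply Subtype.ext
      change {g | g ∈ X ∧ e' * g ≠ 0} = {g | g ∈ X ∧ e * g ≠ 0}
      rw [hclass e' he' g hg.1 hg.2, hclass e he f hf.1 hf.2, hclass f hf.1 g hg.1 hfg]
    exact hle hu'
  · rw [eq_top_iff, ← hX, Submodule.span_le]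
    intro e he
    exact Submodule.mem_iSup_of_mem (p := fun S : {S : Set A // ∃ e ∈ X,
        S = {g | g ∈ X ∧ e * g ≠ 0}} => (NonUnitalAlgebra.adjoin F S.1).toSubmodule)
      ⟨_, e, he, rfl⟩ (NonUnitalAlgebra.subset_adjoin F ⟨he, hself e he⟩)
  · rintro ⟨_, e, he, rfl⟩ ⟨_, e', he', rfl⟩ hne x hx y hy
    have hx' : x ∈ Submodule.span F {g | g ∈ X ∧ e * g ≠ 0} := by
      rw [← (h.mono fun g hg => hg.1 : IsUFamily F lam
        {g | g ∈ X ∧ e * g ≠ 0}).adjoin_toSubmodule]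
      exact hx
    have hy' : y ∈ Submodule.span F {g | g ∈ X ∧ e' * g ≠ 0} := by
      rw [← (h.mono fun g hg => hg.1 : IsUFamily F lam
        {g | g ∈ X ∧ e' * g ≠ 0}).adjoin_toSubmodule]
      exact hy
    refine mul_eq_zero_of_mem_span ?_ hx' hy'
    intro f hf g hg
    by_contra hfg
    apply hne
    apply Subtype.ext
    change {g | g ∈ X ∧ e * g ≠ 0} = {g | g ∈ X ∧ e' * g ≠ 0}
    rw [hclass e' he' g hg.1 hg.2, hclass e he f hf.1 hf.2, hclass f hf.1 g hg.1 hfg]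
  · rintro ⟨_, e, he, rfl⟩
    refine (h.mono fun g hg => hg.1 : IsUFamily F lam {g | g ∈ X ∧ e * g ≠ 0}).isU
      ⟨e, he, hself e he⟩ ?_
    intro f hf g hg
    exact h.trans f hf.1 e he g hg.1 (h.symm e he f hf.1 hf.2) hg.2

theorem adjoin_isProductOfU (h : IsUFamily F lam X) (h0 : lam ≠ 0) :
    IsProductOfU F (NonUnitalAlgebra.adjoin F X) lam := by
  refine isProductOfU (X := {x : NonUnitalAlgebra.adjoin F X | (x : A) ∈ X}) ?_ h0
    (span_preimage_eq_top h.adjoin_toSubmodule)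
  have hc : ∀ x y : NonUnitalAlgebra.adjoin F X, x * y ≠ 0 ↔ (x : A) * y ≠ 0 := by
    intro x y
    rw [Ne, Ne, ← NonUnitalSubalgebra.coe_mul, ZeroMemClass.coe_eq_zero]
  refine ⟨fun e he h0 => h.ne_zero e he (by rw [h0]; rfl),
    fun e he => Subtype.ext (h.idem e he), fun e he f hf hef => Subtype.ext
      (h.mul e he f hf ((hc e f).1 hef)), fun e he f hf hef => (hc f e).2
      (h.symm e he f hf ((hc e f).1 hef)), fun e he f hf g hg hef hfg => (hc e g).2
      (h.trans e he f hf g hg ((hc e f).1 hef) ((hc f g).1 hfg))⟩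

end IsUFamily

end Product

/-! ### Axes of equal and of swapped types -/

section Pairs

variable {F : Type*} {A : Type*} [Field F] [NonUnitalNonAssocRing A] [Module F A]
  [IsScalarTower F A A] [SMulCommClass F A A]

namespace IsPrimitiveAxis

variable {lam del : F} {a b c : A}

/-- Multiplication of axes of the same noncommutative type. -/
theorem mul_same_type (ha : IsPrimitiveAxis F lam del a) (hb : IsPrimitiveAxis F lam del b)
    (hld : lam + del = 1) (hne : lam ≠ del) (h : a * b ≠ 0) :
    a * b = del • a + lam • b ∧ b * a = del • b + lam • a := by
  by_cases hc : a * b = b * a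
  · rcases ha.eq_or_mul_eq_zero hne hb hc with rfl | h'
    · rw [ha.idem, ← add_smul, add_comm, hld, one_smul]
      exact ⟨rfl, rfl⟩
    · exact absurd h'.1 h
  · rcases (ha.noncommuting hb hc).2 with h1 | h1
    · exact h1.2.2
    · exact absurd h1.1 hne

/-- If `a * c = 0`, then `b - c` is odd and `a` even for `c`, so `b * a = (b - c) * a` is odd. But
`b * a = del • b + lam • a` has even part `del • c + lam • a`, which `c` does not annihilate. -/
theorem mul_ne_zero_trans (ha : IsPrimitiveAxis F lam del a) (hb : IsPrimitiveAxis F lam del b)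
    (hc : IsPrimitiveAxis F lam del c) (hld : lam + del = 1) (hne : lam ≠ del)
    (hab : a * b ≠ 0) (hbc : b * c ≠ 0) : a * c ≠ 0 := by
  intro hac
  obtain ⟨e1, e2⟩ := ha.mul_same_type hb hld hne hab
  obtain ⟨e3, e4⟩ := hb.mul_same_type hc hld hne hbc
  have hca := ha.mul_eq_zero_comm.1 hac
  have hcb : c * b ≠ 0 := fun h => hbc (hc.mul_eq_zero_comm.1 h)
  have hodd : b - c ∈ eigenspace F c lam del := by
    constructor
    · change c * (b - c) = lam • (b - c)
      rw [mul_sub, e4, hc.idem]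
      linear_combination (norm := module) hld • c
    · change (b - c) * c = del • (b - c)
      rw [sub_mul, e3, hc.idem]
      linear_combination (norm := module) hld • c
  have ha0 : a ∈ evenPart F c := mem_evenPart_of_mul_eq_zero hca hac
  have h1 : b * a ∈ eigenspace F c lam del := by
    have := hc.odd_mul_even _ hodd a ha0
    rwa [sub_mul, hca, sub_zero] at this
  have h2 : (del • c + lam • a) + (del • (b - c) - b * a) = 0 := by
    rw [e2]; module
  have h3 := (hc.even_odd_unique (add_mem (Submodule.smul_mem _ _ (self_mem_evenPart c))
    (Submodule.smul_mem _ _ ha0)) (sub_mem (Submodule.smul_mem _ _ hodd) h1) h2).1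
  have h4 := congrArg (c * ·) h3
  simp only [mul_add, mul_smul_comm, hc.idem, hca, smul_zero, add_zero, mul_zero] at h4
  exact (smul_eq_zero.1 h4).elim hc.del_ne_zero hc.ne_zero

/-- The product of two axes of swapped types is up to a factor the difference of two axes of the
same type. -/
theorem mul_swapped_type (ha : IsPrimitiveAxis F lam del a) (hb : IsPrimitiveAxis F del lam b)
    (h2 : (2 : F) ≠ 0) (hne : lam ≠ del) (hnc : ∃ x, a * x ≠ x * a) :
    ∃ a', IsPrimitiveAxis F lam del a' ∧ a * a' ≠ 0 ∧ a * b = (lam / 2) • (a - a') ∧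
      b * a = (del / 2) • (a - a') := by
  by_cases hc : a * b = b * a
  · rcases ha.eq_or_mul_eq_zero hne hb hc with rfl | h'
    · obtain ⟨x, hx⟩ := hnc
      exact absurd (ha.type_unique hb hx).1 hne
    · exact ⟨a, ha, by rw [ha.idem]; exact ha.ne_zero, by rw [h'.1, sub_self, smul_zero],
        by rw [h'.2, sub_self, smul_zero]⟩
  · rcases ha.noncommuting hb hc with ⟨hld, h1 | ⟨-, -, f1, f2, f3, f4, y, hy, hy', hay⟩⟩
    · exact absurd h1.1.symm hne
    -- `lam • a = y + a * b` is the even-odd decomposition with respect to `b`. The second axis is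
    -- therefore the image of `a` under the involution of `b`.
    · have hmiy : lam • miyamoto del b a = y - a * b := by
        rw [← map_smul, hay, hb.miyamoto_add (mem_evenPart_of_mul_eq_zero hy hy') ⟨f3, f4⟩]
      have hdiff : a * b = (lam / 2) • (a - miyamoto del b a) := by
        have : (2 : F) • (a * b) = lam • (a - miyamoto del b a) := by
          rw [smul_sub, hmiy, hay]; module
        rw [div_eq_inv_mul, mul_smul, ← this, smul_smul, inv_mul_cancel₀ h2, one_smul]
      refine ⟨miyamoto del b a, hb.miyamoto_isPrimitiveAxis ha, ?_, hdiff, ?_⟩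
      -- Orthogonality would make `a * b` equal to half of `a`, and then `a * (a * b) = lam • (a *
      -- b)` would give `lam = 1`.
      · intro h0
        have h3 : a * (a * b) = (lam / 2) • a := by
          conv_lhs => rw [hdiff]
          rw [mul_smul_comm, mul_sub, ha.idem, h0, sub_zero]
        rw [f2] at h3
        have h4 : a * b = (2⁻¹ : F) • a := by
          rw [← smul_right_inj ha.lam_ne_zero, h3, smul_smul, div_eq_mul_inv]
        apply hc
        have h5 := f1
        rw [h4, smul_smul] at h5
        have h6 : b * a = (lam⁻¹ * (del * 2⁻¹)) • a := by
          rw [mul_smul, h5, smul_smul, inv_mul_cancel₀ ha.lam_ne_zero, one_smul]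
        have h7 := f2
        rw [h4, mul_smul_comm, ha.idem, smul_smul, ← sub_eq_zero, ← sub_smul] at h7
        have h8 := (smul_eq_zero.1 h7).resolve_right ha.ne_zero
        have h9 : (1 - lam) * 2⁻¹ = 0 := by linear_combination h8
        exact absurd ((mul_eq_zero.1 h9).resolve_right (inv_ne_zero h2))
          (sub_ne_zero.2 ha.lam_ne_one.symm)
      · rw [← smul_right_inj ha.lam_ne_zero, ← f1, hdiff, smul_smul, smul_smul]
        congr 1
        ring

/-- Keeps the second axis supplied by `mul_swapped_type` among the noncentral ones. -/
theorem noncentral_of_mul_ne_zero (ha : IsPrimitiveAxis F lam del a)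
    (hb : IsPrimitiveAxis F lam del b) (hne : lam ≠ del)
    (hnc : ∃ x, a * x ≠ x * a) (h : a * b ≠ 0) : ∃ x, b * x ≠ x * b := by
  by_contra! hcon
  rcases ha.eq_or_mul_eq_zero hne hb (hcon a).symm with rfl | h'
  · obtain ⟨x, hx⟩ := hnc
    exact hx (hcon x)
  · exact h h'.1

end IsPrimitiveAxis

theorem isUFamily_of_axes {lam del : F} {X : Set A} (hld : lam + del = 1) (hne : lam ≠ del)
    (hX : ∀ x ∈ X, IsPrimitiveAxis F lam del x) : IsUFamily F lam X where
  ne_zero e he := (hX e he).ne_zero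
  idem e he := (hX e he).idem
  mul e he f hf h := by
    rw [((hX e he).mul_same_type (hX f hf) hld hne h).1, ← hld, add_sub_cancel_left]
  symm e he f hf h := fun h' => h ((hX e he).mul_eq_zero_comm.2 h')
  trans e he f hf g hg := (hX e he).mul_ne_zero_trans (hX f hf) (hX g hg) hld hne

end Pairs

/-! ### The structure of a uniformly generated factor -/

section Structure

variable {F : Type u} {A : Type v} [Field F] [NonUnitalNonAssocRing A] [Module F A]
  [IsScalarTower F A A] [SMulCommClass F A A] {lam del : F}

/-- No primitive axis of the algebra is central. -/
def AxesNoncentral (F : Type u) (A : Type v) [Field F] [NonUnitalNonAssocRing A] [Module F A]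
    [IsScalarTower F A A] [SMulCommClass F A A] : Prop :=
  ∀ (lam del : F) (a : A), IsPrimitiveAxis F lam del a → ∃ x, a * x ≠ x * a

/-- A central axis commutes with, hence is orthogonal to, every member of `K`. It then annihilates
the whole algebra, although it is a nonzero idempotent. -/
theorem axesNoncentral_of_span {K : Set A} (hK : ∀ a ∈ K, ∃ x, a * x ≠ x * a)
    (hax : ∀ a ∈ K, ∃ lam del : F, IsPrimitiveAxis F lam del a)
    (hspan : Submodule.span F K = ⊤) : AxesNoncentral F A := by
  intro lam del c hc
  by_contra! hcon
  have : ∀ a ∈ K, c * a = 0 := by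
    intro a ha
    obtain ⟨l, d, h⟩ := hax a ha
    obtain ⟨x, hx⟩ := hK a ha
    rcases h.eq_or_mul_eq_zero (h.lam_ne_del_of_mul_ne hx) hc (hcon a).symm with rfl | h'
    · exact absurd (hcon x) hx
    · exact h'.2
  have h0 : c * c = 0 := mul_eq_zero_of_mem_span (F := F) (X := {c}) (Y := K)
    (by rintro x rfl; exact this) (Submodule.mem_span_singleton_self c)
    (hspan ▸ Submodule.mem_top)
  rw [hc.idem] at h0
  exact hc.ne_zero h0

/-- The product of two axes of swapped types is an eigenvector for the axes of these types, and
equivalent axes have the same eigenvalue. -/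
theorem swapped_mul_mem (hnc : AxesNoncentral F A) (h2 : (2 : F) ≠ 0) (hld : lam + del = 1)
    (hne : lam ≠ del) {a a' b : A} (ha : IsPrimitiveAxis F lam del a)
    (ha' : IsPrimitiveAxis F lam del a') (hb : IsPrimitiveAxis F del lam b) :
    (a * a' ≠ 0 → a * b ∈ eigenspace F a' lam del ∧ b * a ∈ eigenspace F a' lam del) ∧
      (a * a' = 0 → a * b ∈ eigenspace F a' 0 0 ∧ b * a ∈ eigenspace F a' 0 0) := by
  -- Both products are multiples of `a - c` with `c` equivalent to `a`. Thus `a'` is orthogonal to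
  -- both or to neither, and in the latter case the `a'` terms cancel in the difference.
  obtain ⟨c, hc, hac, e1, e2⟩ := ha.mul_swapped_type hb h2 hne (hnc _ _ a ha)
  rw [e1, e2]
  constructor
  · intro h
    have h' : a' * a ≠ 0 := fun h0 => h (ha.mul_eq_zero_comm.2 h0)
    have f1 := ha'.mul_same_type ha hld hne h'
    have f2 := ha'.mul_same_type hc hld hne (ha'.mul_ne_zero_trans ha hc hld hne h' hac)
    have key : a - c ∈ eigenspace F a' lam del := by
      constructor
      · change a' * (a - c) = lam • (a - c)
        rw [mul_sub, f1.1, f2.1]; module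
      · change (a - c) * a' = del • (a - c)
        rw [sub_mul, f1.2, f2.2]; module
    exact ⟨Submodule.smul_mem _ _ key, Submodule.smul_mem _ _ key⟩
  · intro h
    have f1 := ha.mul_eq_zero_comm.1 h
    have f2 : c * a' = 0 := by
      by_contra h0
      exact ha.mul_ne_zero_trans hc ha' hld hne hac h0 h
    have f3 := hc.mul_eq_zero_comm.1 f2
    have key : a - c ∈ eigenspace F a' 0 0 := by
      constructor
      · change a' * (a - c) = (0 : F) • (a - c)
        rw [mul_sub, f1, f3, sub_zero, zero_smul]
      · change (a - c) * a' = (0 : F) • (a - c)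
        rw [sub_mul, h, f2, sub_zero, zero_smul]
    exact ⟨Submodule.smul_mem _ _ key, Submodule.smul_mem _ _ key⟩

theorem swapped_mul_comm (hnc : AxesNoncentral F A) (h2 : (2 : F) ≠ 0)
    (hne : lam ≠ del) {a b : A} (ha : IsPrimitiveAxis F lam del a)
    (hb : IsPrimitiveAxis F del lam b) : b * a = (del / lam) • (a * b) := by
  obtain ⟨c, -, -, e1, e2⟩ := ha.mul_swapped_type hb h2 hne (hnc _ _ a ha)
  rw [e1, e2, smul_smul]
  congr 1
  have := ha.lam_ne_zero
  field_simp

variable {X' X'' : Set A}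

omit [IsScalarTower F A A] [SMulCommClass F A A] in
theorem mul_mem_crossSpan {x y : A} (hx : x ∈ X') (hy : y ∈ X'') : x * y ∈ crossSpan F X' X'' :=
  Submodule.subset_span ⟨x, hx, y, hy, rfl⟩

theorem crossSpan_comm (hnc : AxesNoncentral F A) (h2 : (2 : F) ≠ 0)
    (hne : lam ≠ del) (hX' : ∀ x ∈ X', IsPrimitiveAxis F lam del x)
    (hX'' : ∀ x ∈ X'', IsPrimitiveAxis F del lam x) :
    crossSpan F X' X'' = crossSpan F X'' X' := by
  apply le_antisymm
  · refine Submodule.span_le.2 ?_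
    rintro _ ⟨x, hx, y, hy, rfl⟩
    rw [swapped_mul_comm hnc h2 hne.symm (hX'' y hy) (hX' x hx)]
    exact Submodule.smul_mem _ _ (mul_mem_crossSpan hy hx)
  · refine Submodule.span_le.2 ?_
    rintro _ ⟨x, hx, y, hy, rfl⟩
    rw [swapped_mul_comm hnc h2 hne (hX' y hy) (hX'' x hx)]
    exact Submodule.smul_mem _ _ (mul_mem_crossSpan hy hx)

/-- Axes of type `(lam, del)` map the space `Z` spanned by products to itself. -/
theorem axis_mul_crossSpan (hnc : AxesNoncentral F A) (h2 : (2 : F) ≠ 0) (hld : lam + del = 1)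
    (hne : lam ≠ del) (hX' : ∀ x ∈ X', IsPrimitiveAxis F lam del x)
    (hX'' : ∀ x ∈ X'', IsPrimitiveAxis F del lam x) {a : A} (ha : IsPrimitiveAxis F lam del a)
    {z : A} (hz : z ∈ crossSpan F X' X'') :
    a * z ∈ crossSpan F X' X'' ∧ z * a ∈ crossSpan F X' X'' := by
  have key : crossSpan F X' X'' ≤ (crossSpan F X' X'').comap (LinearMap.mulLeft F a) ⊓
      (crossSpan F X' X'').comap (LinearMap.mulRight F a) := by
    refine Submodule.span_le.2 ?_
    rintro _ ⟨x, hx, y, hy, rfl⟩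
    have hmem : x * y ∈ crossSpan F X' X'' := mul_mem_crossSpan hx hy
    have h := swapped_mul_mem hnc h2 hld hne (hX' x hx) ha (hX'' y hy)
    change a * (x * y) ∈ crossSpan F X' X'' ∧ x * y * a ∈ crossSpan F X' X''
    by_cases h0 : x * a = 0
    · obtain ⟨⟨e1, e2⟩, -⟩ := h.2 h0
      exact ⟨e1 ▸ Submodule.smul_mem _ _ hmem, e2 ▸ Submodule.smul_mem _ _ hmem⟩
    · obtain ⟨⟨e1, e2⟩, -⟩ := h.1 h0
      exact ⟨e1 ▸ Submodule.smul_mem _ _ hmem, e2 ▸ Submodule.smul_mem _ _ hmem⟩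
  exact key hz

/-- Axes of type `(lam, del)` with nonzero product act in the same way on `Z`. -/
theorem axis_mul_eq_on_crossSpan (hnc : AxesNoncentral F A) (h2 : (2 : F) ≠ 0)
    (hld : lam + del = 1) (hne : lam ≠ del) (hX' : ∀ x ∈ X', IsPrimitiveAxis F lam del x)
    (hX'' : ∀ x ∈ X'', IsPrimitiveAxis F del lam x) {a x : A} (ha : IsPrimitiveAxis F lam del a)
    (hx : IsPrimitiveAxis F lam del x) (hax : a * x ≠ 0) {z : A} (hz : z ∈ crossSpan F X' X'') :
    a * z = x * z ∧ z * a = z * x := by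
  have key : crossSpan F X' X'' ≤
      LinearMap.eqLocus (LinearMap.mulLeft F a) (LinearMap.mulLeft F x) ⊓
      LinearMap.eqLocus (LinearMap.mulRight F a) (LinearMap.mulRight F x) := by
    refine Submodule.span_le.2 ?_
    rintro _ ⟨s, hs, y, hy, rfl⟩
    have h := swapped_mul_mem hnc h2 hld hne (hX' s hs) ha (hX'' y hy)
    have h' := swapped_mul_mem hnc h2 hld hne (hX' s hs) hx (hX'' y hy)
    change a * (s * y) = x * (s * y) ∧ s * y * a = s * y * x
    have hxa : x * a ≠ 0 := fun h0 => hax (ha.mul_eq_zero_comm.2 h0)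
    by_cases h0 : s * a = 0
    · obtain ⟨⟨e1, e2⟩, -⟩ := h.2 h0
      have h0' : s * x = 0 := by
        by_contra h1
        exact (hX' s hs).mul_ne_zero_trans hx ha hld hne h1 hxa h0
      obtain ⟨⟨e1', e2'⟩, -⟩ := h'.2 h0'
      exact ⟨e1.trans e1'.symm, e2.trans e2'.symm⟩
    · obtain ⟨⟨e1, e2⟩, -⟩ := h.1 h0
      obtain ⟨⟨e1', e2'⟩, -⟩ := h'.1 ((hX' s hs).mul_ne_zero_trans ha hx hld hne h0 hax)
      exact ⟨e1.trans e1'.symm, e2.trans e2'.symm⟩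
  exact key hz

/-- A generator of `Z` is a multiple of a difference of equivalent axes, and equivalent axes act
alike on `Z`. -/
theorem crossSpan_mul_crossSpan (hnc : AxesNoncentral F A) (h2 : (2 : F) ≠ 0)
    (hld : lam + del = 1) (hne : lam ≠ del) (hX' : ∀ x ∈ X', IsPrimitiveAxis F lam del x)
    (hX'' : ∀ x ∈ X'', IsPrimitiveAxis F del lam x) {z w : A} (hz : z ∈ crossSpan F X' X'')
    (hw : w ∈ crossSpan F X' X'') : z * w = 0 := by
  have key : crossSpan F X' X'' ≤ LinearMap.ker (LinearMap.mulRight F w) := by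
    refine Submodule.span_le.2 ?_
    rintro _ ⟨a, ha, b, hb, rfl⟩
    obtain ⟨c, hc, hac, e1, -⟩ :=
      (hX' a ha).mul_swapped_type (hX'' b hb) h2 hne (hnc _ _ a (hX' a ha))
    change a * b * w = 0
    rw [e1, smul_mul_assoc, sub_mul,
      (axis_mul_eq_on_crossSpan hnc h2 hld hne hX' hX'' (hX' a ha) hc hac hw).1, sub_self,
      smul_zero]
  exact key hz

theorem span_axes_mul (hnc : AxesNoncentral F A) (h2 : (2 : F) ≠ 0)
    (hne : lam ≠ del) (hX' : ∀ x ∈ X', IsPrimitiveAxis F lam del x)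
    (hX'' : ∀ x ∈ X'', IsPrimitiveAxis F del lam x) {x y : A} (hx : x ∈ Submodule.span F X')
    (hy : y ∈ Submodule.span F X'') :
    x * y ∈ crossSpan F X' X'' ∧ y * x ∈ crossSpan F X' X'' := by
  refine ⟨mul_mem_of_mem_span (fun a ha b hb => mul_mem_crossSpan ha hb) hx hy, ?_⟩
  rw [crossSpan_comm hnc h2 hne hX' hX'']
  exact mul_mem_of_mem_span (fun a ha b hb => mul_mem_crossSpan ha hb) hy hx

theorem span_sup_crossSpan_eq_top (hnc : AxesNoncentral F A) (h2 : (2 : F) ≠ 0)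
    (hld : lam + del = 1) (hne : lam ≠ del) (hX' : ∀ x ∈ X', IsPrimitiveAxis F lam del x)
    (hX'' : ∀ x ∈ X'', IsPrimitiveAxis F del lam x)
    (hgen : NonUnitalAlgebra.adjoin F (X' ∪ X'') = ⊤) :
    Submodule.span F X' ⊔ Submodule.span F X'' ⊔ crossSpan F X' X'' = ⊤ := by
  have hld' : del + lam = 1 := by rw [add_comm, hld]
  have hspan : Submodule.span F X' ⊔ Submodule.span F X'' ⊔ crossSpan F X' X'' =
      Submodule.span F (X' ∪ X'' ∪ {z | ∃ x' ∈ X', ∃ x'' ∈ X'', z = x' * x''}) := by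
    rw [Submodule.span_union, Submodule.span_union]; rfl
  rw [hspan]
  have hZ : crossSpan F X' X'' ≤
      Submodule.span F (X' ∪ X'' ∪ {z | ∃ x' ∈ X', ∃ x'' ∈ X'', z = x' * x''}) :=
    hspan ▸ le_sup_right
  have hS' : Submodule.span F X' ≤
      Submodule.span F (X' ∪ X'' ∪ {z | ∃ x' ∈ X', ∃ x'' ∈ X'', z = x' * x''}) :=
    hspan ▸ le_sup_left.trans le_sup_left
  have hS'' : Submodule.span F X'' ≤
      Submodule.span F (X' ∪ X'' ∪ {z | ∃ x' ∈ X', ∃ x'' ∈ X'', z = x' * x''}) :=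
    hspan ▸ le_sup_right.trans le_sup_left
  have hcomm := crossSpan_comm hnc h2 hne hX' hX''
  have hmemZ : ∀ z, (∃ x' ∈ X', ∃ x'' ∈ X'', z = x' * x'') → z ∈ crossSpan F X' X'' :=
    fun z hz => Submodule.subset_span hz
  have hmul' : ∀ x ∈ X', ∀ z ∈ crossSpan F X' X'', x * z ∈ crossSpan F X' X'' ∧
      z * x ∈ crossSpan F X' X'' := fun x hx z hz =>
    axis_mul_crossSpan hnc h2 hld hne hX' hX'' (hX' x hx) hz
  have hmul'' : ∀ x ∈ X'', ∀ z ∈ crossSpan F X' X'', x * z ∈ crossSpan F X' X'' ∧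
      z * x ∈ crossSpan F X' X'' := fun x hx z hz => by
    rw [hcomm] at hz ⊢
    exact axis_mul_crossSpan hnc h2 hld' hne.symm hX'' hX' (hX'' x hx) hz
  refine span_eq_top_of_adjoin_eq_top hgen Set.subset_union_left ?_
  rintro x ((hx | hx) | hx) y ((hy | hy) | hy)
  · exact hS' ((isUFamily_of_axes hld hne hX').mul_mem_span x hx y hy)
  · exact hZ (mul_mem_crossSpan hx hy)
  · exact hZ (hmul' x hx y (hmemZ y hy)).1
  · exact hZ (span_axes_mul hnc h2 hne hX' hX'' (Submodule.subset_span hy)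
      (Submodule.subset_span hx)).2
  · exact hS'' ((isUFamily_of_axes hld' hne.symm hX'').mul_mem_span x hx y hy)
  · exact hZ (hmul'' x hx y (hmemZ y hy)).1
  · exact hZ (hmul' y hy x (hmemZ x hx)).2
  · exact hZ (hmul'' y hy x (hmemZ x hx)).2
  · rw [crossSpan_mul_crossSpan hnc h2 hld hne hX' hX'' (hmemZ _ hx) (hmemZ _ hy)]
    exact zero_mem _

theorem crossSpan_isIdeal (hnc : AxesNoncentral F A) (h2 : (2 : F) ≠ 0)
    (hld : lam + del = 1) (hne : lam ≠ del) (hX' : ∀ x ∈ X', IsPrimitiveAxis F lam del x)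
    (hX'' : ∀ x ∈ X'', IsPrimitiveAxis F del lam x)
    (hgen : NonUnitalAlgebra.adjoin F (X' ∪ X'') = ⊤) {z : A} (hz : z ∈ crossSpan F X' X'')
    (x : A) : x * z ∈ crossSpan F X' X'' ∧ z * x ∈ crossSpan F X' X'' := by
  have hld' : del + lam = 1 := by rw [add_comm, hld]
  have hcomm := crossSpan_comm hnc h2 hne hX' hX''
  have key : Submodule.span F X' ⊔ Submodule.span F X'' ⊔ crossSpan F X' X'' ≤
      (crossSpan F X' X'').comap (LinearMap.mulRight F z) ⊓
      (crossSpan F X' X'').comap (LinearMap.mulLeft F z) := by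
    refine sup_le (sup_le (Submodule.span_le.2 fun a ha => ?_)
      (Submodule.span_le.2 fun a ha => ?_)) fun w hw => ?_
    · exact axis_mul_crossSpan hnc h2 hld hne hX' hX'' (hX' a ha) hz
    · rw [hcomm] at hz ⊢
      exact axis_mul_crossSpan hnc h2 hld' hne.symm hX'' hX' (hX'' a ha) hz
    · change w * z ∈ crossSpan F X' X'' ∧ z * w ∈ crossSpan F X' X''
      rw [crossSpan_mul_crossSpan hnc h2 hld hne hX' hX'' hw hz,
        crossSpan_mul_crossSpan hnc h2 hld hne hX' hX'' hz hw]
      exact ⟨zero_mem _, zero_mem _⟩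
  rw [span_sup_crossSpan_eq_top hnc h2 hld hne hX' hX'' hgen] at key
  exact key (Submodule.mem_top (x := x))

/-- Products of axes of swapped types are combinations of axes of the first type. -/
theorem crossSpan_le_span_axes (hnc : AxesNoncentral F A) (h2 : (2 : F) ≠ 0)
    (hne : lam ≠ del) (hX' : ∀ x ∈ X', IsPrimitiveAxis F lam del x)
    (hX'' : ∀ x ∈ X'', IsPrimitiveAxis F del lam x) :
    crossSpan F X' X'' ≤ Submodule.span F {x | IsPrimitiveAxis F lam del x} := by
  refine Submodule.span_le.2 ?_
  rintro _ ⟨a, ha, b, hb, rfl⟩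
  obtain ⟨c, hc, -, e1, -⟩ :=
    (hX' a ha).mul_swapped_type (hX'' b hb) h2 hne (hnc _ _ a (hX' a ha))
  rw [SetLike.mem_coe, e1]
  exact Submodule.smul_mem _ _
    (sub_mem (Submodule.subset_span (hX' a ha)) (Submodule.subset_span hc))

/-- The structure of an algebra spanned by noncentral axes of the types `(lam, 1 - lam)` and
`(1 - lam, lam)`. -/
theorem hasNoncommutativeStructure (hnc : AxesNoncentral F A) (h2 : (2 : F) ≠ 0)
    (h0 : lam ≠ 0) (h1 : lam ≠ 1) (hne : lam ≠ 1 - lam)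
    (hA : IsUniformlyGenerated F A lam (1 - lam)) : HasNoncommutativeStructure F A lam := by
  have hld : lam + (1 - lam) = 1 := add_sub_cancel _ _
  have hld' : (1 - lam) + lam = 1 := sub_add_cancel _ _
  have h0' : 1 - lam ≠ 0 := sub_ne_zero.2 h1.symm
  refine ⟨fun a a' b ha ha' hb => swapped_mul_mem hnc h2 hld hne ha ha' hb, ?_, ?_, ?_⟩
  · intro a a' b ha ha' hb
    exact swapped_mul_mem hnc h2 hld' hne.symm ha ha' hb
  · intro u hu
    -- All axes of the two types are used: the Miyamoto images occurring in products are then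
    -- included, so `Z` lies in the span of either type.
    set K' : Set A := {x | IsPrimitiveAxis F lam (1 - lam) x} with hK'
    set K'' : Set A := {x | IsPrimitiveAxis F (1 - lam) lam x} with hK''
    have k' : ∀ x ∈ K', IsPrimitiveAxis F lam (1 - lam) x := fun x hx => hx
    have k'' : ∀ x ∈ K'', IsPrimitiveAxis F (1 - lam) lam x := fun x hx => hx
    obtain ⟨X, hX, hgen⟩ := hA
    have hgen' : NonUnitalAlgebra.adjoin F (K' ∪ K'') = ⊤ := by
      rw [eq_top_iff, ← hgen]
      exact NonUnitalAlgebra.adjoin_mono fun x hx => hX x hx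
    have hcomm := crossSpan_comm hnc h2 hne k' k''
    have hle' := crossSpan_le_span_axes hnc h2 hne k' k''
    have hle'' := crossSpan_le_span_axes hnc h2 hne.symm k'' k'
    have htop := span_sup_crossSpan_eq_top hnc h2 hld hne k' k'' hgen'
    have hu' : ∀ (l d : F) (a : A), IsPrimitiveAxis F l d a → a * u = 0 := by
      intro l d a ha
      rcases hu with hu | hu
      · exact hu a
      · exact ha.mul_eq_zero_comm.2 (hu a)
    have hmem : u ∈ Submodule.span F K' ⊔ Submodule.span F K'' := by
      rw [sup_eq_left.2 (hle'.trans le_sup_left)] at htop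
      rw [htop]; exact Submodule.mem_top
    obtain ⟨u', hu1, u'', hu2, rfl⟩ := Submodule.mem_sup.1 hmem
    -- For `e ∈ K'`, `e * u' = -(e * u'')` lies in `Z`, whence `u' ∈ Z`. As `Z` is also in the span
    -- of `K''`, the whole of `u` is, and it is annihilated by `K''`.
    have hz : u' ∈ crossSpan F K' K'' := by
      refine (isUFamily_of_axes hld hne k').mem_of_mul_mem h0 (fun e he z hz =>
        (axis_mul_crossSpan hnc h2 hld hne k' k'' he hz).1) hu1 fun e he => ?_
      have h3 := hu' _ _ e he
      rw [mul_add, add_eq_zero_iff_eq_neg] at h3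
      rw [h3]
      exact neg_mem (span_axes_mul hnc h2 hne k' k'' (Submodule.subset_span he) hu2).1
    rw [hcomm] at hz
    exact (isUFamily_of_axes hld' hne.symm k'').eq_zero_of_mul_eq_zero h0'
      (add_mem (hle'' hz) hu2) fun e he => hu' _ _ e he
  · intro X' X'' hX' hX'' hgen
    have fam' := isUFamily_of_axes hld hne hX'
    have fam'' := isUFamily_of_axes hld' hne.symm hX''
    have htop := span_sup_crossSpan_eq_top hnc h2 hld hne hX' hX'' hgen
    have hideal : ∀ z ∈ crossSpan F X' X'', ∀ x : A,
        x * z ∈ crossSpan F X' X'' ∧ z * x ∈ crossSpan F X' X'' :=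
      fun z hz x => crossSpan_isIdeal hnc h2 hld hne hX' hX'' hgen hz x
    refine ⟨fam'.adjoin_isProductOfU h0, fam''.adjoin_isProductOfU h0', hideal,
      fun z hz w hw => crossSpan_mul_crossSpan hnc h2 hld hne hX' hX'' hz hw, ?_, ?_, ?_, ?_, ?_⟩
    · rw [fam'.adjoin_toSubmodule, fam''.adjoin_toSubmodule]
      exact htop
    · rw [fam'.adjoin_toSubmodule, fam''.adjoin_toSubmodule]
      refine le_antisymm ?_ (le_inf le_sup_right le_sup_right)
      rintro x ⟨hx1, hx2⟩
      obtain ⟨u', hu', z, hz, rfl⟩ := Submodule.mem_sup.1 hx1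
      obtain ⟨u'', hu'', w, hw, hzw⟩ := Submodule.mem_sup.1 hx2
      -- Modulo `Z` the element `u'` agrees with `u''`, so the axes in `X'` multiply it into `Z`.
      refine add_mem (fam'.mem_of_mul_mem h0 (fun e _ z hz => (hideal z hz e).1) hu'
        fun e he => ?_) hz
      have : u' = u'' + w - z := by rw [hzw, add_sub_cancel_right]
      rw [this, mul_sub, mul_add]
      exact sub_mem (add_mem (span_axes_mul hnc h2 hne hX' hX'' (Submodule.subset_span he) hu'').1
        (hideal w hw e).1) (hideal z hz e).1
    · intro x hx y hy
      refine span_axes_mul hnc h2 hne hX' hX'' ?_ ?_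
      · rw [← fam'.adjoin_toSubmodule]; exact hx
      · rw [← fam''.adjoin_toSubmodule]; exact hy
    · intro a x ha hx hax
      have key : ∀ z ∈ crossSpan F X' X'', a * z = x * z ∧ z * a = z * x := fun z hz =>
        axis_mul_eq_on_crossSpan hnc h2 hld hne hX' hX'' ha hx hax hz
      have key' : ∀ μ η : F, eigenspace F a μ η ⊓ crossSpan F X' X'' =
          eigenspace F x μ η ⊓ crossSpan F X' X'' := by
        intro μ η
        ext z
        simp only [Submodule.mem_inf, mem_eigenspace]
        refine and_congr_left fun hz => ?_
        rw [(key z hz).1, (key z hz).2]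
      exact ⟨key' _ _, key' _ _⟩
    · intro hf' hf''
      have hfin : {z : A | ∃ x' ∈ X', ∃ x'' ∈ X'', z = x' * x''}.Finite := by
        refine ((hf'.prod hf'').image fun p => p.1 * p.2).subset ?_
        rintro _ ⟨x, hx, y, hy, rfl⟩
        exact ⟨(x, y), ⟨hx, hy⟩, rfl⟩
      refine Module.finite_def.2 ?_
      rw [← htop]
      exact ((Submodule.fg_span hf').sup (Submodule.fg_span hf'')).sup (Submodule.fg_span hfin)

end Structure

/-! ### Passage to subalgebras; central and noncentral axes -/

section Subalgebra

variable {F : Type*} {A : Type*} [Field F] [NonUnitalNonAssocRing A] [Module F A]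
  [IsScalarTower F A A] [SMulCommClass F A A]

omit [IsScalarTower F A A] in
theorem mem_leftEigenspace_coe {B : NonUnitalSubalgebra F A} {a x : B} {μ : F} :
    x ∈ leftEigenspace F a μ ↔ (x : A) ∈ leftEigenspace F (a : A) μ :=
  Subtype.ext_iff

omit [SMulCommClass F A A] in
theorem mem_rightEigenspace_coe {B : NonUnitalSubalgebra F A} {a x : B} {μ : F} :
    x ∈ rightEigenspace F a μ ↔ (x : A) ∈ rightEigenspace F (a : A) μ :=
  Subtype.ext_iff

theorem mem_eigenspace_coe {B : NonUnitalSubalgebra F A} {a x : B} {μ η : F} :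
    x ∈ eigenspace F a μ η ↔ (x : A) ∈ eigenspace F (a : A) μ η :=
  and_congr mem_leftEigenspace_coe mem_rightEigenspace_coe

omit [IsScalarTower F A A] [SMulCommClass F A A] in
theorem mem_span_singleton_coe {B : NonUnitalSubalgebra F A} {a x : B} :
    x ∈ Submodule.span F {a} ↔ (x : A) ∈ Submodule.span F {(a : A)} := by
  rw [Submodule.mem_span_singleton, Submodule.mem_span_singleton]
  exact exists_congr fun c => Subtype.ext_iff

theorem mem_evenPart_coe {B : NonUnitalSubalgebra F A} {a x : B} :
    x ∈ evenPart F a ↔ (x : A) ∈ evenPart F (a : A) := by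
  rw [mem_evenPart, mem_evenPart]
  constructor
  · rintro ⟨c, y, h1, h2, rfl⟩
    exact ⟨c, y, congrArg Subtype.val h1, congrArg Subtype.val h2, rfl⟩
  · rintro ⟨c, y, h1, h2, h3⟩
    have hy : ((x - c • a : B) : A) = y := by
      change (x : A) - c • (a : A) = y
      rw [h3, add_sub_cancel_left]
    refine ⟨c, x - c • a, Subtype.ext ?_, Subtype.ext ?_, (add_sub_cancel _ _).symm⟩
    · change (a : A) * ((x - c • a : B) : A) = 0
      rw [hy, h1]
    · change ((x - c • a : B) : A) * (a : A) = 0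
      rw [hy, h2]

namespace IsPrimitiveAxis

variable {lam del lam' del' : F} {a b : A}

/-- A primitive axis of an algebra is a primitive axis of each subalgebra containing it. -/
theorem restrict {B : NonUnitalSubalgebra F A} {a : B}
    (h : IsPrimitiveAxis F lam del (a : A)) : IsPrimitiveAxis F lam del a where
  lam_ne_zero := h.lam_ne_zero
  lam_ne_one := h.lam_ne_one
  del_ne_zero := h.del_ne_zero
  del_ne_one := h.del_ne_one
  ne_zero h0 := h.ne_zero (by rw [h0]; rfl)
  idem := Subtype.ext h.idem
  comm y := Subtype.ext (h.comm y)
  left_primitive := by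
    ext x
    rw [mem_leftEigenspace_coe, h.left_primitive, mem_span_singleton_coe]
  right_primitive := by
    ext x
    rw [mem_rightEigenspace_coe, h.right_primitive, mem_span_singleton_coe]
  decomposition := by
    rw [eq_top_iff]
    intro x _
    -- The odd projection is a polynomial in left multiplication by `a`, so it preserves `B`, and
    -- the components of `x` stay in `B`.
    have ho : oddProj lam a x ∈ eigenspace F a lam del ∧ x - oddProj lam a x ∈ evenPart F a := by
      rw [mem_eigenspace_coe, mem_evenPart_coe]
      have hc : ((oddProj lam a x : B) : A) = oddProj lam (a : A) (x : A) := rfl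
      have hc' : ((x - oddProj lam a x : B) : A) = (x : A) - oddProj lam (a : A) (x : A) := rfl
      rw [hc, hc']
      obtain ⟨e, he, o, ho, hx⟩ := h.exists_even_odd (x : A)
      rw [hx, map_add, h.oddProj_of_even he, h.oddProj_of_odd ho.1, zero_add,
        add_sub_cancel_right]
      exact ⟨ho, he⟩
    rw [← sub_add_cancel x (oddProj lam a x)]
    exact Submodule.add_mem_sup ho.2 ho.1
  even_mul_even x hx y hy :=
    mem_evenPart_coe.2 (h.even_mul_even x (mem_evenPart_coe.1 hx) y (mem_evenPart_coe.1 hy))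
  even_mul_odd x hx y hy :=
    mem_eigenspace_coe.2 (h.even_mul_odd x (mem_evenPart_coe.1 hx) y (mem_eigenspace_coe.1 hy))
  odd_mul_even x hx y hy :=
    mem_eigenspace_coe.2 (h.odd_mul_even x (mem_eigenspace_coe.1 hx) y (mem_evenPart_coe.1 hy))
  odd_mul_odd x hx y hy :=
    mem_evenPart_coe.2 (h.odd_mul_odd x (mem_eigenspace_coe.1 hx) y (mem_eigenspace_coe.1 hy))

theorem type_eq_or_swap (ha : IsPrimitiveAxis F lam del a) (hb : IsPrimitiveAxis F lam' del' b)
    (hnc : ∃ x, a * x ≠ x * a) (h : a * b ≠ 0) :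
    (lam' = lam ∧ del' = del) ∨ (lam' = del ∧ del' = lam) := by
  obtain ⟨x, hx⟩ := hnc
  by_cases hc : a * b = b * a
  · rcases ha.eq_or_mul_eq_zero (ha.lam_ne_del_of_mul_ne hx) hb hc with rfl | h'
    · have := ha.type_unique hb hx
      exact Or.inl ⟨this.1.symm, this.2.symm⟩
    · exact absurd h'.1 h
  · rcases (ha.noncommuting hb hc).2 with h1 | h1
    · exact Or.inl ⟨h1.1, h1.2.1⟩
    · exact Or.inr ⟨h1.1, h1.2.1⟩

end IsPrimitiveAxis

variable (F A) in
/-- The noncentral axes of the types `(lam, del)` and `(del, lam)`. -/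
def noncentralAxes (lam del : F) : Set A :=
  {a | (IsPrimitiveAxis F lam del a ∨ IsPrimitiveAxis F del lam a) ∧ ∃ x, a * x ≠ x * a}

variable (F A) in
/-- The axes that commute with all elements of the algebra. -/
def centralAxes : Set A :=
  {a | (∃ lam del : F, IsPrimitiveAxis F lam del a) ∧ ∀ x, a * x = x * a}

variable {lam del : F}

theorem noncentralAxes_comm : noncentralAxes F A lam del = noncentralAxes F A del lam := by
  ext a
  exact and_congr_left fun _ => or_comm

theorem noncentralAxes_mul_of_type (h2 : (2 : F) ≠ 0) (hld : lam + del = 1) {a b : A}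
    (ha : IsPrimitiveAxis F lam del a) (hnc : ∃ x, a * x ≠ x * a)
    (hb : b ∈ noncentralAxes F A lam del) :
    a * b ∈ Submodule.span F (noncentralAxes F A lam del) := by
  obtain ⟨x, hx⟩ := hnc
  have hne := ha.lam_ne_del_of_mul_ne hx
  have haK : a ∈ noncentralAxes F A lam del := ⟨Or.inl ha, x, hx⟩
  rcases hb with ⟨hb | hb, hbnc⟩
  · by_cases h : a * b = 0
    · rw [h]; exact zero_mem _
    · rw [(ha.mul_same_type hb hld hne h).1]
      exact add_mem (Submodule.smul_mem _ _ (Submodule.subset_span haK))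
        (Submodule.smul_mem _ _ (Submodule.subset_span ⟨Or.inl hb, hbnc⟩))
  · obtain ⟨c, hc, hac, e1, -⟩ := ha.mul_swapped_type hb h2 hne ⟨x, hx⟩
    rw [e1]
    exact Submodule.smul_mem _ _ (sub_mem (Submodule.subset_span haK)
      (Submodule.subset_span ⟨Or.inl hc, ha.noncentral_of_mul_ne_zero hc hne ⟨x, hx⟩ hac⟩))

theorem noncentralAxes_mul (h2 : (2 : F) ≠ 0) (hld : lam + del = 1) :
    ∀ a ∈ noncentralAxes F A lam del, ∀ b ∈ noncentralAxes F A lam del,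
      a * b ∈ Submodule.span F (noncentralAxes F A lam del) := by
  rintro a ⟨ha | ha, hnc⟩ b hb
  · exact noncentralAxes_mul_of_type h2 hld ha hnc hb
  · rw [noncentralAxes_comm] at hb ⊢
    exact noncentralAxes_mul_of_type h2 (by rw [add_comm, hld]) ha hnc hb

theorem centralAxes_mul (h2 : (2 : F) ≠ 0) :
    ∀ a ∈ centralAxes F A, ∀ b ∈ centralAxes F A,
      a * b ∈ Submodule.span F (centralAxes F A) := by
  rintro a ⟨⟨l, d, ha⟩, hac⟩ b ⟨⟨l', d', hb⟩, hbc⟩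
  refine Submodule.span_mono ?_ (ha.mul_mem_span h2 b)
  rintro x (rfl | rfl | rfl)
  · exact ⟨⟨l, d, ha⟩, hac⟩
  · exact ⟨⟨l', d', hb⟩, hbc⟩
  · refine ⟨⟨l', d', ha.miyamoto_isPrimitiveAxis hb⟩, fun x => ?_⟩
    -- Automorphic images of central elements are central.
    rw [← ha.miyamoto_miyamoto x, ← ha.miyamoto_mul, ← ha.miyamoto_mul, hbc]

/-- The hypothesis compares the sets and not the parameters, because swapping `lam` and `del` gives
the same class. -/
theorem noncentralAxes_mul_eq_zero {lam del lam' del' : F}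
    (h : noncentralAxes F A lam del ≠ noncentralAxes F A lam' del') {a b : A}
    (ha : a ∈ noncentralAxes F A lam del) (hb : b ∈ noncentralAxes F A lam' del') :
    a * b = 0 := by
  by_contra hab
  apply h
  rcases ha with ⟨ha | ha, hnc⟩ <;> rcases hb with ⟨hb | hb, -⟩ <;>
    rcases ha.type_eq_or_swap hb hnc hab with ⟨rfl, rfl⟩ | ⟨rfl, rfl⟩ <;>
    first | rfl | exact noncentralAxes_comm

theorem noncentralAxes_mul_centralAxes {a b : A} (ha : a ∈ noncentralAxes F A lam del)
    (hb : b ∈ centralAxes F A) : a * b = 0 ∧ b * a = 0 := by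
  obtain ⟨ha, x, hx⟩ := ha
  obtain ⟨⟨l, d, hb⟩, hc⟩ := hb
  have key : ∀ p q : F, IsPrimitiveAxis F p q a → a * b = 0 ∧ b * a = 0 := by
    intro p q ha
    rcases ha.eq_or_mul_eq_zero (ha.lam_ne_del_of_mul_ne hx) hb (hc a).symm with rfl | h
    · exact absurd (hc x) hx
    · exact h
  exact ha.elim (key _ _) (key _ _)

theorem span_axes_eq_top (h2 : (2 : F) ≠ 0) (hA : IsPAJ F A) :
    Submodule.span F {a : A | ∃ lam del : F, IsPrimitiveAxis F lam del a} = ⊤ := by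
  obtain ⟨X, hX, hgen⟩ := hA
  refine span_eq_top_of_adjoin_eq_top hgen (fun x hx => hX x hx) ?_
  rintro a ⟨l, d, ha⟩ b ⟨l', d', hb⟩
  refine Submodule.span_mono ?_ (ha.mul_mem_span h2 b)
  rintro x (rfl | rfl | rfl)
  · exact ⟨l, d, ha⟩
  · exact ⟨l', d', hb⟩
  · exact ⟨l', d', ha.miyamoto_isPrimitiveAxis hb⟩

/-- The axes span, so an element commuting with all of them is central. -/
theorem exists_axis_not_commute (h2 : (2 : F) ≠ 0) (hA : IsPAJ F A) {a : A}
    (ha : ∃ x, a * x ≠ x * a) :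
    ∃ b, (∃ lam del : F, IsPrimitiveAxis F lam del b) ∧ a * b ≠ b * a := by
  by_contra! hcon
  obtain ⟨x, hx⟩ := ha
  apply hx
  have : Submodule.span F {a : A | ∃ lam del : F, IsPrimitiveAxis F lam del a} ≤
      LinearMap.eqLocus (LinearMap.mulLeft F a) (LinearMap.mulRight F a) :=
    Submodule.span_le.2 fun b hb => hcon b hb
  rw [span_axes_eq_top h2 hA] at this
  exact this (Submodule.mem_top (x := x))

theorem axis_mem (h2 : (2 : F) ≠ 0) (hA : IsPAJ F A) {a : A}
    (ha : IsPrimitiveAxis F lam del a) :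
    a ∈ centralAxes F A ∨ a ∈ noncentralAxes F A lam (1 - lam) := by
  by_cases hc : ∀ x, a * x = x * a
  · exact Or.inl ⟨⟨lam, del, ha⟩, hc⟩
  · push Not at hc
    obtain ⟨b, ⟨l, d, hb⟩, hab⟩ := exists_axis_not_commute h2 hA hc
    have : del = 1 - lam := by
      rw [← (ha.noncommuting hb hab).1, add_sub_cancel_left]
    subst this
    exact Or.inr ⟨Or.inl ha, hc⟩

theorem exists_noncentralAxes_not_commute (h2 : (2 : F) ≠ 0) (hA : IsPAJ F A) {a : A}
    (ha : a ∈ noncentralAxes F A lam del) :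
    ∃ b ∈ noncentralAxes F A lam del, a * b ≠ b * a := by
  obtain ⟨b, ⟨l, d, hb⟩, hab⟩ := exists_axis_not_commute h2 hA ha.2
  refine ⟨b, ⟨?_, a, hab.symm⟩, hab⟩
  rcases ha.1 with ha | ha
  · rcases (ha.noncommuting hb hab).2 with ⟨rfl, rfl, -⟩ | ⟨rfl, rfl, -⟩
    exacts [Or.inl hb, Or.inr hb]
  · rcases (ha.noncommuting hb hab).2 with ⟨rfl, rfl, -⟩ | ⟨rfl, rfl, -⟩
    exacts [Or.inr hb, Or.inl hb]

theorem lam_ne_of_mem_noncentralAxes {a : A} (ha : a ∈ noncentralAxes F A lam del) :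
    lam ≠ 0 ∧ lam ≠ 1 ∧ lam ≠ del := by
  obtain ⟨ha | ha, x, hx⟩ := ha
  · exact ⟨ha.lam_ne_zero, ha.lam_ne_one, ha.lam_ne_del_of_mul_ne hx⟩
  · exact ⟨ha.del_ne_zero, ha.del_ne_one, (ha.lam_ne_del_of_mul_ne hx).symm⟩

omit [IsScalarTower F A A] in
/-- Orthogonal subalgebras, all but one of which have no nonzero annihilating elements, are
independent. -/
theorem iSupIndep_of_mul_eq_zero {ι : Type*} {B : Option ι → NonUnitalSubalgebra F A}
    (horth : ∀ i j, i ≠ j → ∀ x ∈ B i, ∀ y ∈ B j, x * y = 0)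
    (hann : ∀ i : ι, ∀ u ∈ B (some i), (∀ x ∈ B (some i), x * u = 0) → u = 0) :
    iSupIndep fun i => (B i).toSubmodule := by
  have hmul : ∀ i, ∀ x ∈ B i, ∀ u ∈ (⨆ j, ⨆ (_ : j ≠ i), (B j).toSubmodule), x * u = 0 := by
    intro i x hx
    have : (⨆ j, ⨆ (_ : j ≠ i), (B j).toSubmodule) ≤ LinearMap.ker (LinearMap.mulLeft F x) :=
      iSup₂_le fun j hj y hy => horth i j hj.symm x hx y hy
    exact fun u hu => this hu
  intro k
  rw [Submodule.disjoint_def]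
  intro u hu hu'
  cases k with
  | some i => exact hann i u hu fun x hx => hmul _ x hx u hu'
  | none =>
    have hle : (⨆ j, ⨆ (_ : j ≠ none), (B j).toSubmodule) ≤ ⨆ i, (B (some i)).toSubmodule := by
      refine iSup₂_le fun j hj => ?_
      obtain ⟨i, rfl⟩ := Option.ne_none_iff_exists'.1 hj
      exact le_iSup (fun i => (B (some i)).toSubmodule) i
    obtain ⟨f, hf, rfl⟩ := (Submodule.mem_iSup_iff_exists_finsupp _ _).1 (hle hu')
    -- Multiplying the sum by an element of the `i`-th factor isolates its `i`-th term, so every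
    -- term annihilates its factor.
    refine Finset.sum_eq_zero fun i hi => hann i _ (hf i) fun x hx => ?_
    have h0 : x * ∑ j ∈ f.support, f j = 0 := horth _ _ (Option.some_ne_none i) x hx _ hu
    rw [Finset.mul_sum, Finset.sum_eq_single_of_mem i hi] at h0
    · exact h0
    · intro j _ hji
      exact horth _ _ (fun h => hji (Option.some_injective _ h).symm) x hx _ (hf j)

theorem isCPAJ_adjoin_centralAxes (h2 : (2 : F) ≠ 0) :
    IsCPAJ F (NonUnitalAlgebra.adjoin F (centralAxes F A)) := by
  have hS := adjoin_toSubmodule_eq_span (centralAxes_mul (F := F) (A := A) h2)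
  refine ⟨⟨{x | (x : A) ∈ centralAxes F A}, ?_,
    adjoin_eq_top_of_span_eq_top (span_preimage_eq_top hS)⟩, ?_⟩
  · rintro x ⟨⟨l, d, hx⟩, -⟩
    exact ⟨l, d, hx.restrict⟩
  · intro x y
    apply Subtype.ext
    have : Submodule.span F (centralAxes F A) ≤
        LinearMap.eqLocus (LinearMap.mulRight F (y : A)) (LinearMap.mulLeft F (y : A)) :=
      Submodule.span_le.2 fun c hc => hc.2 y
    exact this (hS ▸ x.2)

end Subalgebra

/-! ### Assembly of the decomposition -/

section Main

variable {F : Type u} {A : Type v} [Field F] [NonUnitalNonAssocRing A] [Module F A]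
  [IsScalarTower F A A] [SMulCommClass F A A] {lam : F}

theorem structure_adjoin_noncentralAxes (h2 : (2 : F) ≠ 0) (hA : IsPAJ F A)
    (hne : (noncentralAxes F A lam (1 - lam)).Nonempty) :
    IsUniformlyGenerated F (NonUnitalAlgebra.adjoin F (noncentralAxes F A lam (1 - lam)))
        lam (1 - lam) ∧
      (∃ x y : NonUnitalAlgebra.adjoin F (noncentralAxes F A lam (1 - lam)), x * y ≠ y * x) ∧
      HasNoncommutativeStructure F
        (NonUnitalAlgebra.adjoin F (noncentralAxes F A lam (1 - lam))) lam := by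
  obtain ⟨a, ha⟩ := hne
  obtain ⟨h0, h1, hl⟩ := lam_ne_of_mem_noncentralAxes ha
  have hT := span_preimage_eq_top (adjoin_toSubmodule_eq_span
    (noncentralAxes_mul (A := A) h2 (add_sub_cancel lam 1)))
  -- A partner that does not commute with `x` can be taken in the same class, so noncentrality
  -- survives in the subalgebra.
  have hnc : ∀ x : NonUnitalAlgebra.adjoin F (noncentralAxes F A lam (1 - lam)),
      (x : A) ∈ noncentralAxes F A lam (1 - lam) → ∃ y, x * y ≠ y * x := by
    intro x hx
    obtain ⟨b, hb, hxb⟩ := exists_noncentralAxes_not_commute h2 hA hx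
    exact ⟨⟨b, NonUnitalAlgebra.subset_adjoin F hb⟩, fun h => hxb (congrArg Subtype.val h)⟩
  have hU : IsUniformlyGenerated F
      (NonUnitalAlgebra.adjoin F (noncentralAxes F A lam (1 - lam))) lam (1 - lam) :=
    ⟨{x | (x : A) ∈ noncentralAxes F A lam (1 - lam)},
      fun x hx => hx.1.imp (fun h => h.restrict) (fun h => h.restrict),
      adjoin_eq_top_of_span_eq_top hT⟩
  refine ⟨hU, ⟨⟨a, NonUnitalAlgebra.subset_adjoin F ha⟩, hnc _ ha⟩, ?_⟩
  refine hasNoncommutativeStructure (axesNoncentral_of_span hnc ?_ hT) h2 h0 h1 hl hU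
  rintro x ⟨hx | hx, -⟩
  · exact ⟨_, _, hx.restrict⟩
  · exact ⟨_, _, hx.restrict⟩

end Main

end PAJ

theorem theorem3p10 (F : Type u) (A : Type v) [Field F] [NonUnitalNonAssocRing A] [Module F A]
    [IsScalarTower F A A] [SMulCommClass F A A] (hchar : ringChar F ≠ 2)
    (hA : PAJ.IsPAJ F A) :
    ∃ (ι : Type v) (lam : ι → F) (B : Option ι → NonUnitalSubalgebra F A),
      PAJ.IsDirectProduct B ∧
      (∀ i : ι,
        lam i ≠ 0 ∧ lam i ≠ 1 ∧ lam i ≠ 1 - lam i ∧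
        PAJ.IsUniformlyGenerated F (B (some i)) (lam i) (1 - lam i) ∧
        (∃ x y : B (some i), x * y ≠ y * x) ∧
        PAJ.HasNoncommutativeStructure F (B (some i)) (lam i)) ∧
      PAJ.IsCPAJ F (B none) := by
  have h2 : (2 : F) ≠ 0 := Ring.two_ne_zero hchar
  let K : F → Set A := fun l => PAJ.noncentralAxes F A l (1 - l)
  have hspan : ∀ l, (NonUnitalAlgebra.adjoin F (K l)).toSubmodule = Submodule.span F (K l) :=
    fun l => PAJ.adjoin_toSubmodule_eq_span (PAJ.noncentralAxes_mul h2 (add_sub_cancel l 1))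
  have hspan' := PAJ.adjoin_toSubmodule_eq_span (PAJ.centralAxes_mul (F := F) (A := A) h2)
  -- The index is the class itself, since `l` and `1 - l` determine the same factor. A parameter is
  -- then chosen for each class.
  let ι : Type v := {S : Set A // ∃ l, S = K l ∧ (K l).Nonempty}
  choose lam hlam using fun i : ι => i.2
  let B : Option ι → NonUnitalSubalgebra F A := fun o =>
    o.elim (NonUnitalAlgebra.adjoin F (PAJ.centralAxes F A))
      fun i => NonUnitalAlgebra.adjoin F (K (lam i))
  have hstruct := fun i => PAJ.structure_adjoin_noncentralAxes h2 hA (hlam i).2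
  have horth : ∀ i j, i ≠ j → ∀ x ∈ B i, ∀ y ∈ B j, x * y = 0 := by
    rintro (_ | i) (_ | j) hij x hx y hy
    · exact absurd rfl hij
    · exact PAJ.mul_eq_zero_of_mem_span
        (fun a ha b hb => (PAJ.noncentralAxes_mul_centralAxes hb ha).2)
        (hspan'.le hx) ((hspan (lam j)).le hy)
    · exact PAJ.mul_eq_zero_of_mem_span
        (fun a ha b hb => (PAJ.noncentralAxes_mul_centralAxes ha hb).1)
        ((hspan (lam i)).le hx) (hspan'.le hy)
    · refine PAJ.mul_eq_zero_of_mem_span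
        (fun a ha b hb => PAJ.noncentralAxes_mul_eq_zero (fun h => hij ?_) ha hb)
        ((hspan (lam i)).le hx) ((hspan (lam j)).le hy)
      exact congrArg some (Subtype.ext ((hlam i).1.trans (h.trans (hlam j).1.symm)))
  refine ⟨ι, lam, B, ⟨PAJ.iSupIndep_of_mul_eq_zero horth ?_, ?_, horth⟩, ?_,
    PAJ.isCPAJ_adjoin_centralAxes h2⟩
  · intro i u hu hann
    have := (hstruct i).2.2.no_annihilating ⟨u, hu⟩
      (Or.inl fun x => Subtype.ext (hann x x.2))
    exact congrArg Subtype.val this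
  · rw [eq_top_iff, ← PAJ.span_axes_eq_top h2 hA, Submodule.span_le]
    rintro a ⟨l, d, ha⟩
    rcases PAJ.axis_mem h2 hA ha with h | h
    · exact Submodule.mem_iSup_of_mem (p := fun o => (B o).toSubmodule) none
        (NonUnitalAlgebra.subset_adjoin F h)
    · let i : ι := ⟨K l, l, rfl, a, h⟩
      refine Submodule.mem_iSup_of_mem (p := fun o => (B o).toSubmodule) (some i)
        (NonUnitalAlgebra.subset_adjoin F ?_)
      rw [← (hlam i).1]
      exact h
  · intro i
    obtain ⟨a, ha⟩ := (hlam i).2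
    obtain ⟨h0, h1, hl⟩ := PAJ.lam_ne_of_mem_noncentralAxes ha
    exact ⟨h0, h1, hl, hstruct i⟩
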